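/- Fix a template matrix $T \in \mathbb{R}^{m \times n}$, let $\overline{\mathbb{R}} = \mathbb{R} \cup \{-\infty,\infty\}$, and let $\gamma(d) = \{x \in \mathbb{R}^n \mid Tx \le d\}$ for $d \in \overline{\mathbb{R}}^m$ and $\alpha(S) = \bigwedge\{d \mid S \subseteq \gamma(d)\}$ for $S \subseteq \mathbb{R}^n$. Statements $s$ are built from affine assignments $x := Ax+b$ and affine guards $Ax \le b$ by sequential composition $s_0;s_1$ and choice $s_0 \mid s_1$; $[\![s]\!]$ is the collecting semantics on subsets of $\mathbb{R}^n$, and $[\![s]\!]^\sharp = \alpha \circ [\![s]\!] \circ \gamma$. A system $\mathcal{E}$ of abstract semantic equations over a finite set $\mathbf{X}$ of variables has one equation $\mathbf{x} = e_1 \vee \cdots \vee e_k$ ($k \ge 1$) for each $\mathbf{x} \in \mathbf{X}$, where each $e_i$ is a constant from $\overline{\mathbb{R}}$ or of the form $[\![s]\!]^\sharp_{j\cdot}(\mathbf{x}_1,\ldots,\mathbf{x}_m)$ with $\mathbf{x}_1,\ldots,\mathbf{x}_m \in \mathbf{X}$. Let $[\![\mathcal{E}]\!]$ be the induced monotone operator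 on $\mathbf{X} \to \overline{\mathbb{R}}$ and $\mu[\![\mathcal{E}]\!]$ its least fixpoint. A strategy $\sigma$ selects, for each equation, one disjunct $e_i$ and, if it is of the form $[\![s]\!]^\sharp_{j\cdot}(\ldots)$, one side for every position of a choice in $s$; $\mathcal{E}(\sigma)$ is the resulting system, and $\Sigma$ the set of strategies for $\mathcal{E}$. A strategy $\sigma'$ is an improvement of $\sigma$ w.r.t. a pre-solution $\rho$ of $\mathcal{E}(\sigma)$ if (1) $[\![\mathcal{E}(\sigma')]\!]\rho > \rho$ unless $\rho$ solves $\mathcal{E}$, and (2) wherever $\sigma'$ selects a different expression than $\sigma$ does, the value of that expression at $\rho$ is strictly larger. The strategy improvement algorithm is run on $\mathcal{E} \vee -\infty := \{\mathbf{x} = e \vee -\infty \mid \mathbf{x} = e \in \mathcal{E}\}$; it starts with the strategy $\sigma$ that selects $-\infty$ everywhere and with $\rho$ constantly $-\infty$, and, while $\rho$ is not a solution, replaces $\sigma$ by an improvement of $\sigma$ w.r.t. $\rho$ and then $\rho$ by the least solution $\ge \rho$ of $(\mathcal{E} \vee -\infty)(\sigma)$. Theorem. Let $\mathcal{E}$ be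 a system of abstract semantic equations with $\mu[\![\mathcal{E}]\!](\mathbf{x}) < \infty$ for all $\mathbf{x} \in \mathbf{X}$. Then, whatever improvements are chosen, the strategy improvement algorithm terminates, computes $\mu[\![\mathcal{E}]\!]$, and performs at most $|\Sigma| + |\mathbf{X}|$ improvement steps. For each improvement step it suffices to do the following: 1. Find models for (or establish the unsatisfiability of) $|\mathbf{X}|$ SAT modulo real linear arithmetic formulas, one for each equation, each of which has linear size and can be constructed in linear time; the models determine an improvement. 2. Solve one linear programming problem of linear size that can be constructed in linear time; it has an optimal solution, and every optimal solution determines the new $\rho$. Here linear time refers to the uniform cost measure, with an absolute constant, in the size of the equation (for a formula) and of the system (for the linear program); the template matrix counts as a part of each expression $[\![s]\!]^\sharp_{j\cdot}(\mathbf{x}_1,\ldots,\mathbf{x}_m)$. -/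

import Mathlib

open scoped Matrix

namespace TemplateAnalysis

noncomputable section

universe u v

/-! ### Statements, collecting semantics, template domains, abstract semantics -/

/-- Statements over the program variables `x = (x₁, …, xₙ)`: affine assignments `x := A x + b`,
affine guards `A x ≤ b`, sequential composition `s₀ ; s₁` and choice `s₀ ∣ s₁`. -/
inductive Stmt (n : ℕ) : Type
  | assign (A : Matrix (Fin n) (Fin n) ℝ) (b : Fin n → ℝ) : Stmt n
  | guard (k : ℕ) (A : Matrix (Fin k) (Fin n) ℝ) (b : Fin k → ℝ) : Stmt n
  | seq (s₀ s₁ : Stmt n) : Stmt n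
  | choice (s₀ s₁ : Stmt n) : Stmt n

/-- The collecting semantics of a statement. -/
def Stmt.collect {n : ℕ} : Stmt n → Set (Fin n → ℝ) → Set (Fin n → ℝ)
  | .assign A b, S => (fun x => A *ᵥ x + b) '' S
  | .guard _ A b, S => {x | x ∈ S ∧ A *ᵥ x ≤ b}
  | .seq s₀ s₁, S => s₁.collect (s₀.collect S)
  | .choice s₀ s₁, S => s₀.collect S ∪ s₁.collect S

/-- Concretization `γ(d) = {x ∣ T x ≤ d}`. -/
def conc {n m : ℕ} (T : Matrix (Fin m) (Fin n) ℝ) (d : Fin m → EReal) : Set (Fin n → ℝ) :=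
  {x | ∀ i, (((T *ᵥ x) i : ℝ) : EReal) ≤ d i}

/-- Abstraction `α(S) = ⋀ {d ∣ S ⊆ γ(d)}`. -/
def abstr {n m : ℕ} (T : Matrix (Fin m) (Fin n) ℝ) (S : Set (Fin n → ℝ)) : Fin m → EReal :=
  sInf {d | S ⊆ conc T d}

/-- The abstract semantics `α ∘ ⟦s⟧ ∘ γ` of a statement. -/
def Stmt.absSem {n m : ℕ} (T : Matrix (Fin m) (Fin n) ℝ) (s : Stmt n) (d : Fin m → EReal) :
    Fin m → EReal :=
  abstr T (s.collect (conc T d))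

theorem Stmt.collect_mono {n : ℕ} (s : Stmt n) : Monotone s.collect := by
  induction s with
  | assign A b => intro S S' h; exact Set.image_mono h
  | guard k A b => intro S S' h x hx; exact ⟨h hx.1, hx.2⟩
  | seq s₀ s₁ h₀ h₁ => intro S S' h; exact h₁ (h₀ h)
  | choice s₀ s₁ h₀ h₁ => intro S S' h; exact Set.union_subset_union (h₀ h) (h₁ h)

theorem Stmt.absSem_mono {n m : ℕ} (T : Matrix (Fin m) (Fin n) ℝ) (s : Stmt n) :
    Monotone (s.absSem T) := by
  intro d d' h
  have h1 : conc T d ⊆ conc T d' := fun x hx i => (hx i).trans (h i)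
  exact sInf_le_sInf fun e he => (s.collect_mono h1).trans he

/-! ### Systems of abstract semantic equations -/

/-- The disjuncts of right-hand sides: a constant of `ℝ ∪ {-∞, ∞}`, or an expression
`⟦s⟧♯_j (x₁, …, xₘ)` with variables `x₁, …, xₘ`. -/
inductive Atom (n m : ℕ) (X : Type u) : Type u
  | const (c : EReal) : Atom n m X
  | abs (s : Stmt n) (j : Fin m) (args : Fin m → X) : Atom n m X

/-- Right-hand sides `e₁ ∨ ⋯ ∨ e_k`, `k ≥ 1`, bracketed in an arbitrary way. -/
inductive Expr (n m : ℕ) (X : Type u) : Type u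
  | atom (a : Atom n m X) : Expr n m X
  | sup (e₀ e₁ : Expr n m X) : Expr n m X

/-- A system of abstract semantic equations: one equation `x = E x` for every variable `x`. -/
abbrev System (n m : ℕ) (X : Type u) : Type u := X → Expr n m X

variable {n m : ℕ} {X : Type u}

def Atom.eval (T : Matrix (Fin m) (Fin n) ℝ) (ρ : X → EReal) : Atom n m X → EReal
  | .const c => c
  | .abs s j args => s.absSem T (fun i => ρ (args i)) j

def Expr.eval (T : Matrix (Fin m) (Fin n) ℝ) (ρ : X → EReal) : Expr n m X → EReal
  | .atom a => a.eval T ρ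
  | .sup e₀ e₁ => e₀.eval T ρ ⊔ e₁.eval T ρ

theorem Expr.eval_mono (T : Matrix (Fin m) (Fin n) ℝ) (e : Expr n m X) :
    Monotone fun ρ => e.eval T ρ := by
  induction e with
  | atom a =>
    intro ρ ρ' h
    cases a with
    | const c => exact le_rfl
    | abs s j args => exact s.absSem_mono T (fun i => h (args i)) j
  | sup e₀ e₁ h₀ h₁ => intro ρ ρ' h; exact sup_le_sup (h₀ h) (h₁ h)

/-- The monotone operator `⟦E⟧` on variable assignments. -/
def System.sem (T : Matrix (Fin m) (Fin n) ℝ) (E : System n m X) :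
    (X → EReal) →o (X → EReal) where
  toFun ρ x := (E x).eval T ρ
  monotone' _ _ h x := (E x).eval_mono T h

/-- The set of solutions of `E`. -/
def System.Sol (T : Matrix (Fin m) (Fin n) ℝ) (E : System n m X) : Set (X → EReal) :=
  {ρ | E.sem T ρ = ρ}

/-- The least solution `μ⟦E⟧`. -/
def System.leastSol (T : Matrix (Fin m) (Fin n) ℝ) (E : System n m X) : X → EReal :=
  OrderHom.lfp (E.sem T)

/-! ### Strategies -/

/-- Strategies for a statement: a bit for every position of a choice. -/
def Stmt.Strat : Stmt n → Type
  | .assign _ _ => Unit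
  | .guard _ _ _ => Unit
  | .seq s₀ s₁ => s₀.Strat × s₁.Strat
  | .choice s₀ s₁ => Bool × s₀.Strat × s₁.Strat

/-- The sequential statement `s σ`. -/
def Stmt.apply : (s : Stmt n) → s.Strat → Stmt n
  | .assign A b, _ => .assign A b
  | .guard k A b, _ => .guard k A b
  | .seq s₀ s₁, σ => .seq (s₀.apply σ.1) (s₁.apply σ.2)
  | .choice s₀ s₁, σ => if σ.1 then s₁.apply σ.2.2 else s₀.apply σ.2.1

/-- Strategies for a disjunct. -/
def Atom.Strat : Atom n m X → Type
  | .const _ => Unit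
  | .abs s _ _ => s.Strat

def Atom.apply : (a : Atom n m X) → a.Strat → Atom n m X
  | .const c, _ => .const c
  | .abs s j args, σ => .abs (s.apply σ) j args

/-- Strategies for `e₀ ∨ e₁`: a side `p`, and a strategy for `e_p`. -/
def Expr.Strat : Expr n m X → Type
  | .atom a => a.Strat
  | .sup e₀ e₁ => e₀.Strat ⊕ e₁.Strat

/-- The expression `e σ`; it is always a single disjunct. -/
def Expr.apply : (e : Expr n m X) → e.Strat → Atom n m X
  | .atom a, σ => a.apply σ
  | .sup e₀ _, .inl σ => e₀.apply σ
  | .sup _ e₁, .inr σ => e₁.apply σ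

/-- The set `Σ` of strategies for a system. -/
abbrev Strategy (E : System n m X) : Type u := (x : X) → (E x).Strat

/-- The system `E(σ)`. -/
def System.apply (E : System n m X) (σ : Strategy E) : System n m X :=
  fun x => .atom ((E x).apply (σ x))

instance Stmt.finite_strat (s : Stmt n) : Finite s.Strat := by
  induction s with
  | assign A b => exact inferInstanceAs (Finite Unit)
  | guard k A b => exact inferInstanceAs (Finite Unit)
  | seq s₀ s₁ h₀ h₁ => exact inferInstanceAs (Finite (s₀.Strat × s₁.Strat))
  | choice s₀ s₁ h₀ h₁ => exact inferInstanceAs (Finite (Bool × s₀.Strat × s₁.Strat))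

instance Expr.finite_strat (e : Expr n m X) : Finite e.Strat := by
  induction e with
  | atom a =>
    cases a with
    | const c => exact inferInstanceAs (Finite Unit)
    | abs s j args => exact inferInstanceAs (Finite s.Strat)
  | sup e₀ e₁ h₀ h₁ => exact inferInstanceAs (Finite (e₀.Strat ⊕ e₁.Strat))

/-- `σ'` is an improvement of `σ` with respect to `ρ`. -/
structure IsImprovement (T : Matrix (Fin m) (Fin n) ℝ) (E : System n m X)
    (σ : Strategy E) (ρ : X → EReal) (σ' : Strategy E) : Prop where
  increase : ρ ∉ E.Sol T → ρ < (E.apply σ').sem T ρ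
  profitable : ∀ x, (E x).apply (σ' x) ≠ (E x).apply (σ x) →
    ((E x).apply (σ x)).eval T ρ < ((E x).apply (σ' x)).eval T ρ

/-- `ρ' = μ_{≥ ρ} ⟦E⟧`: the least solution of `E` that is greater than or equal to `ρ`. -/
def IsLeastSolAbove (T : Matrix (Fin m) (Fin n) ℝ) (E : System n m X)
    (ρ ρ' : X → EReal) : Prop :=
  IsLeast {η | η ∈ E.Sol T ∧ ρ ≤ η} ρ'

/-! ### The strategy improvement algorithm -/

/-- The system `E ∨ -∞`. -/
def System.joinBot (E : System n m X) : System n m X :=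
  fun x => .sup (E x) (.atom (.const ⊥))

/-- The initial strategy: it selects `-∞` in every equation of `E ∨ -∞`. -/
def initStrategy (E : System n m X) : Strategy E.joinBot :=
  fun _ => Sum.inr ()

/-- `Reaches T E k σ ρ`: the program variables of the strategy improvement algorithm, run on
`E ∨ -∞` from the initial strategy and the assignment constantly `-∞`, can have the values
`σ`, `ρ` after `k` evaluations of the loop body
`σ ← (an improvement of σ w.r.t. ρ); ρ ← μ_{≥ ρ} ⟦(E ∨ -∞)(σ)⟧`
of the loop `while ρ ∉ Sol(E ∨ -∞)`.  Every choice of improvements is admitted, so the runs for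
every strategy improvement operator are covered. -/
inductive Reaches (T : Matrix (Fin m) (Fin n) ℝ) (E : System n m X) :
    ℕ → Strategy E.joinBot → (X → EReal) → Prop
  | init : Reaches T E 0 (initStrategy E) (fun _ => ⊥)
  | step {k : ℕ} {σ σ' : Strategy E.joinBot} {ρ ρ' : X → EReal} :
      Reaches T E k σ ρ → ρ ∉ E.joinBot.Sol T →
      IsImprovement T E.joinBot σ ρ σ' →
      IsLeastSolAbove T (E.joinBot.apply σ') ρ ρ' →
      Reaches T E (k + 1) σ' ρ'

/-! ### Sizes of inputs -/

/-- The size of a statement: the number of entries of the matrices and vectors in it, the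
variable vector `x` of each elementary statement included, and of its operators. -/
def Stmt.size : Stmt n → ℕ
  | .assign _ _ => n * n + n + n + 1
  | .guard k _ _ => k * n + k + n + 1
  | .seq s₀ s₁ => s₀.size + s₁.size + 1
  | .choice s₀ s₁ => s₀.size + s₁.size + 1

/-- The size of a disjunct; `⟦s⟧♯_j (x₁, …, xₘ)` consists of `s`, the template matrix, `j`, and
`m` variables. -/
def Atom.size : Atom n m X → ℕ
  | .const _ => 1
  | .abs s _ _ => s.size + m * n + m + 1

def Expr.size : Expr n m X → ℕ
  | .atom a => a.size
  | .sup e₀ e₁ => e₀.size + e₁.size + 1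

def System.size [Fintype X] (E : System n m X) : ℕ := 1 + ∑ x, (E x).size

/-! ### SAT modulo real linear arithmetic, and linear programs -/

/-- Linear expressions over the variables `V`. -/
inductive LinExpr (V : Type v) : Type v
  | const (c : ℝ) : LinExpr V
  | var (x : V) : LinExpr V
  | add (e₁ e₂ : LinExpr V) : LinExpr V
  | smul (c : ℝ) (e : LinExpr V) : LinExpr V

def LinExpr.eval {V : Type v} (z : V → ℝ) : LinExpr V → ℝ
  | .const c => c
  | .var x => z x
  | .add e₁ e₂ => e₁.eval z + e₂.eval z
  | .smul c e => c * e.eval z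

def LinExpr.size {V : Type v} : LinExpr V → ℕ
  | .const _ => 1
  | .var _ => 1
  | .add e₁ e₂ => e₁.size + e₂.size + 1
  | .smul _ e => e.size + 1

/-- SAT modulo real linear arithmetic formulas; real-valued and Boolean variables are numbered. -/
inductive Formula : Type
  | bvar (a : ℕ) : Formula
  | le (e₁ e₂ : LinExpr ℕ) : Formula
  | or (φ₁ φ₂ : Formula) : Formula
  | and (φ₁ φ₂ : Formula) : Formula
  | not (φ : Formula) : Formula

/-- Interpretations. -/
structure Interp : Type where
  real : ℕ → ℝ
  bool : ℕ → Bool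

/-- `I.Models φ`: the interpretation `I` is a model of `φ`. -/
def Interp.Models (I : Interp) : Formula → Prop
  | .bvar a => I.bool a = true
  | .le e₁ e₂ => e₁.eval I.real ≤ e₂.eval I.real
  | .or φ₁ φ₂ => I.Models φ₁ ∨ I.Models φ₂
  | .and φ₁ φ₂ => I.Models φ₁ ∧ I.Models φ₂
  | .not φ => ¬ I.Models φ

def Formula.size : Formula → ℕ
  | .bvar _ => 1
  | .le e₁ e₂ => e₁.size + e₂.size + 1
  | .or φ₁ φ₂ => φ₁.size + φ₂.size + 1
  | .and φ₁ φ₂ => φ₁.size + φ₂.size + 1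
  | .not φ => φ.size + 1

/-- A correct answer to the task of finding a model of `φ`: a model, or `none` if there is no
model. -/
def IsAnswer (φ : Formula) : Option Interp → Prop
  | some I => I.Models φ
  | none => ∀ I : Interp, ¬ I.Models φ

/-- Linear programs `sup {objective ∣ constraints}`, a pair `(e₁, e₂)` standing for the constraint
`e₁ ≤ e₂`.  The matrix of the program is represented sparsely; only the finitely many variables
that occur in the program matter. -/
structure LinProg (V : Type v) : Type v where
  objective : LinExpr V
  constraints : List (LinExpr V × LinExpr V)

def LinProg.IsFeasible {V : Type v} (P : LinProg V) (z : V → ℝ) : Prop :=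
  ∀ c ∈ P.constraints, c.1.eval z ≤ c.2.eval z

/-- `z` is an optimal solution of `P`. -/
def LinProg.IsOptimal {V : Type v} (P : LinProg V) (z : V → ℝ) : Prop :=
  P.IsFeasible z ∧ ∀ z', P.IsFeasible z' → P.objective.eval z' ≤ P.objective.eval z

def LinProg.size {V : Type v} (P : LinProg V) : ℕ :=
  P.objective.size + (P.constraints.map fun c => c.1.size + c.2.size + 1).sum

/-! ### Computations with a step count

The cost measure is uniform: a step is the creation of one node of an expression, a formula, a
list or a record from parts at hand (together with the reading of the matrix entry, vector entry
or variable name that is put there, and the case distinction that selects it). -/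

/-- The result of a computation together with the number of its steps. -/
structure Timed (α : Type v) : Type v where
  val : α
  steps : ℕ

/-- One step, with result `a`. -/
def unitStep {α : Type v} (a : α) : Timed α := ⟨a, 1⟩

instance : Monad Timed where
  pure a := ⟨a, 0⟩
  bind c f := ⟨(f c.val).val, c.steps + (f c.val).steps⟩

/-- The expression `f 0 + (f 1 + ⋯)`. -/
def sumLoop {V : Type v} : (k : ℕ) → (Fin k → Timed (LinExpr V)) → Timed (LinExpr V)
  | 0, _ => unitStep (.const 0)
  | k + 1, f => do
    let e ← f 0
    let r ← sumLoop k fun i => f i.succ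
    unitStep (.add e r)

/-- The expression `a₀ v₀ + (a₁ v₁ + ⋯)`. -/
def rowExpr {V : Type v} (a : Fin n → ℝ) (y : Fin n → V) : Timed (LinExpr V) :=
  sumLoop n fun j => do
    let t ← unitStep (LinExpr.var (y j))
    unitStep (.smul (a j) t)

/-- The expression `a₀ v₀ + (a₁ v₁ + ⋯) + b`. -/
def affExpr {V : Type v} (a : Fin n → ℝ) (b : ℝ) (y : Fin n → V) : Timed (LinExpr V) := do
  let e ← rowExpr a y
  let c ← unitStep (LinExpr.const b)
  unitStep (.add e c)

/-! ### The formulas that determine improved strategies -/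

def mkTrue : Timed Formula := do
  let z ← unitStep (LinExpr.const 0)
  unitStep (.le z z)

def mkFalse : Timed Formula := do
  let a ← unitStep (LinExpr.const 1)
  let z ← unitStep (LinExpr.const 0)
  unitStep (.le a z)

def mkEq (e₁ e₂ : LinExpr ℕ) : Timed Formula := do
  let φ ← unitStep (Formula.le e₁ e₂)
  let ψ ← unitStep (Formula.le e₂ e₁)
  unitStep (.and φ ψ)

/-- The formula `f 0 ∧ (f 1 ∧ ⋯)`. -/
def andLoop : (k : ℕ) → (Fin k → Timed Formula) → Timed Formula
  | 0, _ => mkTrue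
  | k + 1, f => do
    let φ ← f 0
    let ψ ← andLoop k fun i => f i.succ
    unitStep (.and φ ψ)

/-- The formula `(¬ a ∧ φ₀) ∨ (a ∧ φ₁)`. -/
def mkCase (a : ℕ) (φ₀ φ₁ : Formula) : Timed Formula := do
  let β ← unitStep (Formula.bvar a)
  let ν ← unitStep (Formula.not β)
  let ψ₀ ← unitStep (Formula.and ν φ₀)
  let ψ₁ ← unitStep (Formula.and β φ₁)
  unitStep (.or ψ₀ ψ₁)

/-- The block of the `n` variables numbered `r, …, r + n - 1`. -/
def block (n r : ℕ) : Fin n → ℕ := fun j => r + j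

/-- A formula, and the numbers of the next unused real-valued and Boolean variables. -/
structure Built : Type where
  formula : Formula
  nextReal : ℕ
  nextBool : ℕ

/-- The formula `Φ(s)` that relates a state `x` (in the block at `x`) with the states `x'` (in the
block at `x'`) that `s` can produce from it.  The existential quantifiers are fresh real-valued
variables, taken from `r` on; the Boolean variables `a_p` are numbered from `a` on, in the order in
which the choices occur. -/
def stmtFormula : Stmt n → (x x' r a : ℕ) → Timed Built
  | .assign A b, x, x', r, a => do
    let φ ← andLoop n fun i => do
      let l ← unitStep (LinExpr.var (block n x' i))
      let e ← affExpr (A i) (b i) (block n x)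
      mkEq l e
    unitStep ⟨φ, r, a⟩
  | .guard k A b, x, x', r, a => do
    let φ ← andLoop k fun i => do
      let e ← rowExpr (A i) (block n x)
      let c ← unitStep (LinExpr.const (b i))
      unitStep (.le e c)
    let ψ ← andLoop n fun j => do
      let l ← unitStep (LinExpr.var (block n x' j))
      let e ← unitStep (LinExpr.var (block n x j))
      mkEq l e
    let χ ← unitStep (Formula.and φ ψ)
    unitStep ⟨χ, r, a⟩
  | .seq s₀ s₁, x, x', r, a => do
    let B₀ ← stmtFormula s₀ x r (r + n) a
    let B₁ ← stmtFormula s₁ r x' B₀.nextReal B₀.nextBool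
    let φ ← unitStep (Formula.and B₀.formula B₁.formula)
    unitStep ⟨φ, B₁.nextReal, B₁.nextBool⟩
  | .choice s₀ s₁, x, x', r, a => do
    let B₀ ← stmtFormula s₀ x x' r (a + 1)
    let B₁ ← stmtFormula s₁ x x' B₀.nextReal B₀.nextBool
    let φ ← mkCase a B₀.formula B₁.formula
    unitStep ⟨φ, B₁.nextReal, B₁.nextBool⟩

/-- `e ≤ d` for `d ∈ ℝ ∪ {-∞, ∞}`. -/
def mkLeE (e : LinExpr ℕ) (d : EReal) : Timed Formula :=
  if d = ⊥ then mkFalse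
  else if d = ⊤ then mkTrue
  else do
    let c ← unitStep (LinExpr.const d.toReal)
    unitStep (.le e c)

/-- `e > d` for `d ∈ ℝ ∪ {-∞, ∞}`. -/
def mkGtE (e : LinExpr ℕ) (d : EReal) : Timed Formula :=
  if d = ⊥ then mkTrue
  else do
    let φ ← mkLeE e d
    unitStep (.not φ)

/-- For a disjunct `⟦s⟧♯_j (x₁, …, xₘ)`, the formula
`∃ x x', T x ≤ (ρ(x₁), …, ρ(xₘ)) ∧ Φ(s) ∧ v = T_j x'`; for a constant `c`, the formula
`v ≤ c`.  The variable `v` is the real-valued variable number `0`. -/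
def atomFormula (T : Matrix (Fin m) (Fin n) ℝ) (ρ : X → EReal) :
    Atom n m X → (r a : ℕ) → Timed Built
  | .const c, r, a => do
    let w ← unitStep (LinExpr.var 0)
    let φ ← mkLeE w c
    unitStep ⟨φ, r, a⟩
  | .abs s j args, r, a => do
    let φ ← andLoop m fun i => do
      let e ← rowExpr (T i) (block n r)
      mkLeE e (ρ (args i))
    let B ← stmtFormula s r (r + n) (r + n + n) a
    let w ← unitStep (LinExpr.var 0)
    let e ← rowExpr (T j) (block n (r + n))
    let ψ ← mkEq w e
    let χ ← unitStep (Formula.and B.formula ψ)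
    let ω ← unitStep (Formula.and φ χ)
    unitStep ⟨ω, B.nextReal, B.nextBool⟩

def exprFormula (T : Matrix (Fin m) (Fin n) ℝ) (ρ : X → EReal) :
    Expr n m X → (r a : ℕ) → Timed Built
  | .atom α, r, a => atomFormula T ρ α r a
  | .sup e₀ e₁, r, a => do
    let B₀ ← exprFormula T ρ e₀ r (a + 1)
    let B₁ ← exprFormula T ρ e₁ B₀.nextReal B₀.nextBool
    let φ ← mkCase a B₀.formula B₁.formula
    unitStep ⟨φ, B₁.nextReal, B₁.nextBool⟩

/-- The construction of the formula, from `e`, `ρ` and `c`, that expresses `⟦e⟧ρ > c`. -/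
def improveFormula (T : Matrix (Fin m) (Fin n) ℝ) (e : Expr n m X) (ρ : X → EReal) (c : EReal) :
    Timed Formula := do
  let B ← exprFormula T ρ e 1 0
  let w ← unitStep (LinExpr.var 0)
  let φ ← mkGtE w c
  unitStep (.and B.formula φ)

/-- The number of choices in a statement. -/
def Stmt.numBool : Stmt n → ℕ
  | .assign _ _ => 0
  | .guard _ _ _ => 0
  | .seq s₀ s₁ => s₀.numBool + s₁.numBool
  | .choice s₀ s₁ => 1 + s₀.numBool + s₁.numBool

def Expr.numBool : Expr n m X → ℕ
  | .atom (.const _) => 0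
  | .atom (.abs s _ _) => s.numBool
  | .sup e₀ e₁ => 1 + e₀.numBool + e₁.numBool

/-- The strategy `p ↦ M(a_p)` for a statement whose Boolean variables are numbered from `a` on. -/
def Stmt.decode (M : ℕ → Bool) : (s : Stmt n) → ℕ → s.Strat
  | .assign _ _, _ => ()
  | .guard _ _ _, _ => ()
  | .seq s₀ s₁, a => (s₀.decode M a, s₁.decode M (a + s₀.numBool))
  | .choice s₀ s₁, a =>
    (M a, s₀.decode M (a + 1), s₁.decode M (a + 1 + s₀.numBool))

def Expr.decode (M : ℕ → Bool) : (e : Expr n m X) → ℕ → e.Strat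
  | .atom (.const _), _ => ()
  | .atom (.abs s _ _), a => s.decode M a
  | .sup e₀ e₁, a =>
    if M a then .inr (e₁.decode M (a + 1 + e₀.numBool)) else .inl (e₀.decode M (a + 1))

/-- The next strategy, given the answers for the formulas of all variables: the strategy read off
from the model where there is one, and the old one elsewhere. -/
def nextStrategy (E : System n m X) (σ : Strategy E) (ans : X → Option Interp) : Strategy E :=
  fun x => match ans x with
    | none => σ x
    | some I => (E x).decode I.bool 0

/-! ### The linear program that evaluates a strategy -/

/-- The variables of the linear program for a system: the variables of the system, and numbered
auxiliary variables. -/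
abbrev LPVar (X : Type u) : Type u := X ⊕ ℕ

abbrev Constr (X : Type u) : Type u := LinExpr (LPVar X) × LinExpr (LPVar X)

/-- A linear program under construction, and the number of the next unused auxiliary variable. -/
structure LPState (X : Type u) : Type u where
  objective : LinExpr (LPVar X)
  constraints : List (Constr X)
  next : ℕ

/-- The constraints `f 0, f 1, …` are put in front of a list. -/
def consLoop : (k : ℕ) → (Fin k → Timed (Constr X)) → List (Constr X) → Timed (List (Constr X))
  | 0, _, L => unitStep L
  | k + 1, f, L => do
    let c ← f 0
    let L' ← consLoop k (fun i => f i.succ) L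
    unitStep (c :: L')

def auxBlock (X : Type u) (n r : ℕ) : Fin n → LPVar X := fun j => .inr (r + j)

/-- Constraints for `x' ∈ ⟦s σ⟧ {x}`, where `x` and `x'` are blocks of auxiliary variables. -/
def stmtConstr : (s : Stmt n) → s.Strat → (x x' : ℕ) → LPState X → Timed (LPState X)
  | .assign A b, _, x, x', S => do
    let L₁ ← consLoop n (fun i => do
      let l ← unitStep (LinExpr.var (auxBlock X n x' i))
      let e ← affExpr (A i) (b i) (auxBlock X n x)
      unitStep (l, e)) S.constraints
    let L₂ ← consLoop n (fun i => do
      let l ← unitStep (LinExpr.var (auxBlock X n x' i))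
      let e ← affExpr (A i) (b i) (auxBlock X n x)
      unitStep (e, l)) L₁
    unitStep ⟨S.objective, L₂, S.next⟩
  | .guard k A b, _, x, x', S => do
    let L₁ ← consLoop k (fun i => do
      let e ← rowExpr (A i) (auxBlock X n x)
      let c ← unitStep (LinExpr.const (b i))
      unitStep (e, c)) S.constraints
    let L₂ ← consLoop n (fun j => do
      let l ← unitStep (LinExpr.var (auxBlock X n x' j))
      let e ← unitStep (LinExpr.var (auxBlock X n x j))
      unitStep (l, e)) L₁
    let L₃ ← consLoop n (fun j => do
      let l ← unitStep (LinExpr.var (auxBlock X n x' j))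
      let e ← unitStep (LinExpr.var (auxBlock X n x j))
      unitStep (e, l)) L₂
    unitStep ⟨S.objective, L₃, S.next⟩
  | .seq s₀ s₁, σ, x, x', S => do
    let S₀ ← unitStep (⟨S.objective, S.constraints, S.next + n⟩ : LPState X)
    let S₁ ← stmtConstr s₀ σ.1 x S.next S₀
    stmtConstr s₁ σ.2 S.next x' S₁
  | .choice s₀ s₁, σ, x, x', S => do
    let S₀ ← unitStep S
    if σ.1 then stmtConstr s₁ σ.2.2 x x' S₀ else stmtConstr s₀ σ.2.1 x x' S₀

/-- The contribution of the equation `x = a σ`: nothing for `x = -∞`; otherwise the summand `x` of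
the objective, and the constraint `x ≤ c` for a real constant `c`, respectively the constraints
`T y ≤ (x₁, …, xₘ)`, `y' ∈ ⟦s σ⟧ {y}`, `x ≤ T_j y'` for `⟦s σ⟧♯_j (x₁, …, xₘ)`. -/
def atomConstr (T : Matrix (Fin m) (Fin n) ℝ) (x : X) :
    (a : Atom n m X) → a.Strat → LPState X → Timed (LPState X)
  | .const c, _, S =>
    if c = ⊥ then unitStep S
    else do
      let w ← unitStep (LinExpr.var (Sum.inl x))
      let o ← unitStep (LinExpr.add w S.objective)
      if c = ⊤ then unitStep ⟨o, S.constraints, S.next⟩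
      else do
        let d ← unitStep (LinExpr.const c.toReal)
        let p ← unitStep (w, d)
        let L ← unitStep (p :: S.constraints)
        unitStep ⟨o, L, S.next⟩
  | .abs s j args, σ, S => do
    let w ← unitStep (LinExpr.var (Sum.inl x))
    let o ← unitStep (LinExpr.add w S.objective)
    let L ← consLoop m (fun i => do
      let e ← rowExpr (T i) (auxBlock X n S.next)
      let t ← unitStep (LinExpr.var (Sum.inl (args i)))
      unitStep (e, t)) S.constraints
    let e ← rowExpr (T j) (auxBlock X n (S.next + n))
    let p ← unitStep (w, e)
    let L' ← unitStep (p :: L)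
    let S' ← unitStep (⟨o, L', S.next + n + n⟩ : LPState X)
    stmtConstr s σ S.next (S.next + n) S'

def exprConstr (T : Matrix (Fin m) (Fin n) ℝ) (x : X) :
    (e : Expr n m X) → e.Strat → LPState X → Timed (LPState X)
  | .atom a, σ, S => atomConstr T x a σ S
  | .sup e₀ _, .inl σ, S => do
    let S' ← unitStep S
    exprConstr T x e₀ σ S'
  | .sup _ e₁, .inr σ, S => do
    let S' ← unitStep S
    exprConstr T x e₁ σ S'

def systemConstr (T : Matrix (Fin m) (Fin n) ℝ) (E : System n m X) (σ : Strategy E) :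
    List X → LPState X → Timed (LPState X)
  | [], S => unitStep S
  | x :: l, S => do
    let S' ← exprConstr T x (E x) (σ x) S
    systemConstr T E σ l S'

/-- The construction, from `E` and `σ`, of the linear program for `E(σ)`: the sum of the variables
`x` whose equation is not `x = -∞` is maximized. -/
def strategyLP [Fintype X] (T : Matrix (Fin m) (Fin n) ℝ) (E : System n m X) (σ : Strategy E) :
    Timed (LinProg (LPVar X)) := do
  let o ← unitStep (LinExpr.const 0)
  let S ← systemConstr T E σ Finset.univ.toList ⟨o, [], 0⟩
  unitStep ⟨S.objective, S.constraints⟩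

open Classical in
/-- The variable assignment that is read off from a solution `z` of the linear program: `-∞` for
the variables with equation `x = -∞` in `E(σ)`, and the value of `x` in `z` for the others. -/
def lpAssignment (E : System n m X) (σ : Strategy E) (z : LPVar X → ℝ) : X → EReal :=
  fun x => if (E x).apply (σ x) = .const ⊥ then ⊥ else ((z (Sum.inl x) : ℝ) : EReal)

end

end TemplateAnalysis

open TemplateAnalysis

/-!
Write `F_σ` for the operator of the system that a strategy `σ` selects.

*Why the linear program computes the least solution above `ρ`.*  A disjunct without choices is the
value of a linear program in its arguments.  It is therefore concave
(`Expr.lt_eval_apply_of_convex_comb`) and strict in every argument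
(`Stmt.bot_lt_of_bot_lt_absSem`), and its finite values are attained, because projections of
polyhedra are polyhedra, hence closed (`Stmt.exists_of_absSem_eq`, by Fourier–Motzkin elimination).
The feasible points of the linear program for `σ` are the finite pre-solutions of `F_σ`, so its
optimum is the greatest one.  A least solution `ρ` above some pre-solution need not be the greatest
pre-solution in general (consider `x = x`), but it is for the pairs `(σ, ρ)` that the algorithm
visits.  The inductive reason is the notion `Rigid`: no set of variables that are still at their
value in `ρ` can be raised together in a self-supporting way, even after other variables have been
raised.  An improvement step from `ρ` to `ρ'` preserves it
(`Invariant.rigid_of_improvement`): a violating set `A` at `ρ'` contains only variables that the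
step has increased strictly, since the equations of all other variables are unchanged and `ρ` is
rigid; if the variables in `A` can be raised in some direction, then, by concavity, moving them
slightly in the opposite direction gives a post-solution, and it is still above `ρ`, which
contradicts the minimality of `ρ'`.

*Why there are at most `|Σ| + |X|` steps.*  The set of variables with value `> -∞` never shrinks, so
it grows in at most `|X|` steps.  On this set, the selected disjuncts determine the assignment: by
strictness they do not refer to other variables, and the assignment is the greatest pre-solution.
In a step in which the set does not grow, the assignment grows strictly on it, so that no later
strategy agrees with the current one there (`Invariant.retired`).  Completing the strategies
visited before such steps to strategies of `E` thus gives pairwise different elements of `Σ`.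

*Why the formulas determine improvements.*  A model of the formula of `e` is a run of a disjunct of
`e` along the choices that the Boolean variables encode (`le_eval_of_models`), and every run arises
in this way (`exists_models_of_lt_eval`).
-/

namespace TemplateAnalysis

universe u v

variable {n m : ℕ} {X : Type u}

/-! ### Statements as transition relations -/

/-- `s.Rel x x'`: the statement `s` can produce the state `x'` from the state `x`. -/
def Stmt.Rel : Stmt n → (Fin n → ℝ) → (Fin n → ℝ) → Prop
  | .assign A b, x, x' => x' = A *ᵥ x + b
  | .guard _ A b, x, x' => A *ᵥ x ≤ b ∧ x' = x
  | .seq s₀ s₁, x, x' => ∃ y, s₀.Rel x y ∧ s₁.Rel y x'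
  | .choice s₀ s₁, x, x' => s₀.Rel x x' ∨ s₁.Rel x x'

theorem Stmt.mem_collect (s : Stmt n) (S : Set (Fin n → ℝ)) (x' : Fin n → ℝ) :
    x' ∈ s.collect S ↔ ∃ x ∈ S, s.Rel x x' := by
  induction s generalizing S x' with
  | assign A b => simp [Stmt.collect, Stmt.Rel, eq_comm]
  | guard k A b => simp only [Stmt.collect, Stmt.Rel, Set.mem_ofPred_eq]; grind
  | seq s₀ s₁ h₀ h₁ => simp only [Stmt.collect, Stmt.Rel, h₁, h₀]; grind
  | choice s₀ s₁ h₀ h₁ => simp only [Stmt.collect, Stmt.Rel, Set.mem_union, h₁, h₀]; grind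

theorem abstr_apply (T : Matrix (Fin m) (Fin n) ℝ) (S : Set (Fin n → ℝ)) (j : Fin m) :
    abstr T S j = ⨆ x ∈ S, (((T *ᵥ x) j : ℝ) : EReal) := by
  apply le_antisymm
  · have h : abstr T S ≤ fun j => ⨆ x ∈ S, (((T *ᵥ x) j : ℝ) : EReal) :=
      sInf_le fun x hx i => le_iSup₂ (f := fun x (_ : x ∈ S) => (((T *ᵥ x) i : ℝ) : EReal)) x hx
    exact h j
  · refine iSup₂_le fun x hx => ?_
    rw [abstr, sInf_apply]
    exact le_iInf fun d => d.2 hx j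

theorem Stmt.lt_absSem_iff (T : Matrix (Fin m) (Fin n) ℝ) (s : Stmt n) (d : Fin m → EReal)
    (j : Fin m) (r : EReal) :
    r < s.absSem T d j ↔
      ∃ x x', x ∈ conc T d ∧ s.Rel x x' ∧ r < (((T *ᵥ x') j : ℝ) : EReal) := by
  simp only [Stmt.absSem, abstr_apply, lt_iSup_iff, Stmt.mem_collect]
  grind

theorem Stmt.le_absSem (T : Matrix (Fin m) (Fin n) ℝ) {s : Stmt n} {d : Fin m → EReal}
    (j : Fin m) {x x' : Fin n → ℝ} (hx : x ∈ conc T d) (h : s.Rel x x') :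
    (((T *ᵥ x') j : ℝ) : EReal) ≤ s.absSem T d j := by
  rw [Stmt.absSem, abstr_apply]
  exact le_iSup₂ (f := fun x (_ : x ∈ s.collect (conc T d)) => (((T *ᵥ x) j : ℝ) : EReal)) x'
    ((s.mem_collect _ _).2 ⟨x, hx, h⟩)

theorem Stmt.Rel.of_apply {s : Stmt n} {σ : s.Strat} {x x' : Fin n → ℝ}
    (h : (s.apply σ).Rel x x') : s.Rel x x' := by
  induction s generalizing x x' with
  | assign A b => exact h
  | guard k A b => exact h
  | seq s₀ s₁ h₀ h₁ =>
    obtain ⟨y, hy, hy'⟩ := h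
    exact ⟨y, h₀ hy, h₁ hy'⟩
  | choice s₀ s₁ h₀ h₁ =>
    simp only [Stmt.apply] at h
    split at h
    · exact Or.inr (h₁ h)
    · exact Or.inl (h₀ h)

theorem Atom.eval_apply_le (T : Matrix (Fin m) (Fin n) ℝ) (ρ : X → EReal) (a : Atom n m X)
    (σ : a.Strat) : (a.apply σ).eval T ρ ≤ a.eval T ρ := by
  cases a with
  | const c => exact le_rfl
  | abs s j args =>
    refine le_of_forall_lt fun r hr => ?_
    obtain ⟨x, x', hx, h, hr⟩ := ((s.apply σ).lt_absSem_iff T _ j r).1 hr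
    exact (s.lt_absSem_iff T _ j r).2 ⟨x, x', hx, h.of_apply, hr⟩

theorem Expr.eval_apply_le (T : Matrix (Fin m) (Fin n) ℝ) (ρ : X → EReal) (e : Expr n m X)
    (σ : e.Strat) : (e.apply σ).eval T ρ ≤ e.eval T ρ := by
  induction e with
  | atom a => exact a.eval_apply_le T ρ σ
  | sup e₀ e₁ h₀ h₁ =>
    cases σ with
    | inl σ => exact (h₀ σ).trans le_sup_left
    | inr σ => exact (h₁ σ).trans le_sup_right

/-! ### Disjuncts without choices are concave and strict -/

theorem Stmt.Rel.convex_comb {s : Stmt n} {σ : s.Strat} {x x' y y' : Fin n → ℝ}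
    (h : (s.apply σ).Rel x x') (h' : (s.apply σ).Rel y y') {c d : ℝ} (hc : 0 ≤ c) (hd : 0 ≤ d)
    (hcd : c + d = 1) : (s.apply σ).Rel (c • x + d • y) (c • x' + d • y') := by
  induction s generalizing x x' y y' with
  | assign A b =>
    simp only [Stmt.apply, Stmt.Rel] at h h' ⊢
    subst h h'
    have hb : b = c • b + d • b := by rw [← add_smul, hcd, one_smul]
    rw [Matrix.mulVec_add, Matrix.mulVec_smul, Matrix.mulVec_smul, smul_add, smul_add]
    nth_rw 3 [hb]
    abel
  | guard k A b =>
    simp only [Stmt.apply, Stmt.Rel] at h h' ⊢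
    refine ⟨fun i => ?_, by rw [h.2, h'.2]⟩
    have h₁ := h.1 i
    have h₂ := h'.1 i
    rw [Matrix.mulVec_add, Matrix.mulVec_smul, Matrix.mulVec_smul]
    simp only [Pi.add_apply, Pi.smul_apply, smul_eq_mul]
    have : b i = c * b i + d * b i := by rw [← add_mul, hcd, one_mul]
    rw [this]
    gcongr
  | seq s₀ s₁ h₀ h₁ =>
    obtain ⟨z, hz, hz'⟩ := h
    obtain ⟨w, hw, hw'⟩ := h'
    exact ⟨_, h₀ hz hw, h₁ hz' hw'⟩
  | choice s₀ s₁ h₀ h₁ =>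
    simp only [Stmt.apply] at h h' ⊢
    split at h <;> simp_all

/-- Concavity of the disjuncts that strategies select.  The point `ρ` need only dominate the convex
combination of `ρ₁` and `ρ₂`; its values are compared with real lower bounds, so that no
arithmetic with infinite values occurs. -/
theorem Expr.lt_eval_apply_of_convex_comb (T : Matrix (Fin m) (Fin n) ℝ) (e : Expr n m X)
    (σ : e.Strat) {ρ₁ ρ₂ ρ : X → EReal} {c d : ℝ} (hc : 0 < c) (hd : 0 < d) (hcd : c + d = 1)
    (hρ : ∀ x, ∀ u v : ℝ, (u : EReal) ≤ ρ₁ x → (v : EReal) ≤ ρ₂ x →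
      ((c * u + d * v : ℝ) : EReal) ≤ ρ x)
    {r₁ r₂ : ℝ} (h₁ : (r₁ : EReal) < (e.apply σ).eval T ρ₁)
    (h₂ : (r₂ : EReal) < (e.apply σ).eval T ρ₂) :
    ((c * r₁ + d * r₂ : ℝ) : EReal) < (e.apply σ).eval T ρ := by
  induction e with
  | atom a =>
    cases a with
    | const a =>
      simp only [Expr.apply, Atom.apply, Atom.eval] at h₁ h₂ ⊢
      induction a with
      | bot => simp at h₁
      | top => exact EReal.coe_lt_top _
      | coe a =>
        norm_cast at h₁ h₂ ⊢
        have : a = c * a + d * a := by rw [← add_mul, hcd, one_mul]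
        rw [this]
        gcongr
    | abs s j args =>
      obtain ⟨x, x', hx, hxx, hr⟩ := (Stmt.lt_absSem_iff T _ _ j _).1 h₁
      obtain ⟨y, y', hy, hyy, hr'⟩ := (Stmt.lt_absSem_iff T _ _ j _).1 h₂
      refine (Stmt.lt_absSem_iff T _ _ j _).2 ⟨c • x + d • y, c • x' + d • y', fun i => ?_,
        hxx.convex_comb hyy hc.le hd.le hcd, ?_⟩
      · have := hρ (args i) _ _ (hx i) (hy i)
        simpa [Matrix.mulVec_add, Matrix.mulVec_smul] using this
      · norm_cast at hr hr' ⊢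
        simp only [Matrix.mulVec_add, Matrix.mulVec_smul, Pi.add_apply, Pi.smul_apply, smul_eq_mul]
        gcongr
  | sup e₀ e₁ ih₀ ih₁ =>
    cases σ with
    | inl σ => exact ih₀ σ h₁ h₂
    | inr σ => exact ih₁ σ h₁ h₂

/-- Expressions `⟦s⟧♯_j (x₁, …, xₘ)` are strict in all arguments: a template polyhedron with a
bound `-∞` is empty. -/
theorem Stmt.bot_lt_of_bot_lt_absSem (T : Matrix (Fin m) (Fin n) ℝ) {s : Stmt n}
    {d : Fin m → EReal} {j : Fin m} (h : ⊥ < s.absSem T d j) (i : Fin m) : ⊥ < d i := by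
  obtain ⟨x, x', hx, -⟩ := (Stmt.lt_absSem_iff T _ _ j _).1 h
  exact (EReal.bot_lt_coe _).trans_le (hx i)

/-! ### Polyhedra and Fourier–Motzkin elimination -/

/-- Polyhedra: solution sets of finitely many linear inequalities. -/
def IsPolyhedral {E : Type*} [AddCommGroup E] [Module ℝ E] (S : Set E) : Prop :=
  ∃ (ι : Type) (_ : Finite ι) (f : ι → E →ₗ[ℝ] ℝ) (b : ι → ℝ), S = {z | ∀ i, f i z ≤ b i}

theorem exists_forall_mul_le_iff {ι : Type*} [Finite ι] (p r : ι → ℝ) :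
    (∃ y : ℝ, ∀ i, p i * y ≤ r i) ↔
      (∀ i, p i = 0 → 0 ≤ r i) ∧ ∀ i j, 0 < p i → p j < 0 → p j * r i ≤ p i * r j := by
  constructor
  · rintro ⟨y, hy⟩
    refine ⟨fun i hi => by simpa [hi] using hy i, fun i j hi hj => ?_⟩
    nlinarith [mul_le_mul_of_nonneg_left (hy j) hi.le,
      mul_le_mul_of_nonpos_left (hy i) hj.le]
  · rintro ⟨h₀, h⟩
    have hfin : ∀ P : ι → Prop, ((fun i => r i / p i) '' {i | P i}).Finite :=
      fun P => (Set.toFinite _).image _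
    have hle : ∀ i j, 0 < p i → p j < 0 → r j / p j ≤ r i / p i := by
      intro i j hi hj
      rw [div_le_iff_of_neg hj, div_mul_eq_mul_div, div_le_iff₀ hi]
      linarith [h i j hi hj]
    suffices ∃ y : ℝ, (∀ j, p j < 0 → r j / p j ≤ y) ∧ ∀ i, 0 < p i → y ≤ r i / p i by
      obtain ⟨y, hl, hu⟩ := this
      refine ⟨y, fun i => ?_⟩
      rcases lt_trichotomy (p i) 0 with hi | hi | hi
      · have := (div_le_iff_of_neg hi).1 (hl i hi)
        linarith
      · simpa [hi] using h₀ i hi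
      · have := (le_div_iff₀ hi).1 (hu i hi)
        linarith
    by_cases hne : ∃ j, p j < 0
    · obtain ⟨j₀, hj₀⟩ := hne
      refine ⟨sSup ((fun i => r i / p i) '' {i | p i < 0}), fun j hj => ?_, fun i hi => ?_⟩
      · exact le_csSup (hfin _).bddAbove ⟨j, hj, rfl⟩
      · refine csSup_le ⟨_, j₀, hj₀, rfl⟩ ?_
        rintro _ ⟨j, hj, rfl⟩
        exact hle i j hi hj
    · push Not at hne
      exact ⟨sInf ((fun i => r i / p i) '' {i | 0 < p i}), fun j hj => absurd hj (hne j).not_gt,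
        fun i hi => csInf_le (hfin _).bddBelow ⟨i, hi, rfl⟩⟩

section

variable {E F : Type*} [AddCommGroup E] [Module ℝ E] [AddCommGroup F] [Module ℝ F]

theorem IsPolyhedral.preimage {S : Set F} (hS : IsPolyhedral S) (g : E →ₗ[ℝ] F) :
    IsPolyhedral {z | g z ∈ S} := by
  obtain ⟨ι, hι, f, b, rfl⟩ := hS
  exact ⟨ι, hι, fun i => f i ∘ₗ g, b, rfl⟩

theorem IsPolyhedral.inter {S S' : Set E} (hS : IsPolyhedral S) (hS' : IsPolyhedral S') :
    IsPolyhedral {z | z ∈ S ∧ z ∈ S'} := by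
  obtain ⟨ι, hι, f, b, rfl⟩ := hS
  obtain ⟨ι', hι', f', b', rfl⟩ := hS'
  refine ⟨ι ⊕ ι', inferInstance, Sum.elim f f', Sum.elim b b', ?_⟩
  ext z
  simp [Sum.forall]

theorem isPolyhedral_le {ι : Type} [Finite ι] (g : E →ₗ[ℝ] ι → ℝ) (b : ι → ℝ) :
    IsPolyhedral {z | g z ≤ b} :=
  ⟨ι, inferInstance, fun i => LinearMap.proj i ∘ₗ g, b, rfl⟩

theorem isPolyhedral_eq {ι : Type} [Finite ι] (g : E →ₗ[ℝ] ι → ℝ) (b : ι → ℝ) :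
    IsPolyhedral {z | g z = b} := by
  convert (isPolyhedral_le g b).inter (isPolyhedral_le (-g) (-b)) using 3 with z
  simp [le_antisymm_iff]

/-- The elimination step: the translates of a polyhedron along a line form a polyhedron. -/
theorem IsPolyhedral.exists_add_smul {S : Set E} (hS : IsPolyhedral S) (d : E) :
    IsPolyhedral {z | ∃ y : ℝ, z + y • d ∈ S} := by
  obtain ⟨ι, hι, f, b, rfl⟩ := hS
  refine ⟨{i // f i d = 0} ⊕ {i // 0 < f i d} × {i // f i d < 0}, inferInstance,
    Sum.elim (fun i => f i) fun q => f q.1 d • f q.2 - f q.2 d • f q.1,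
    Sum.elim (fun i => b i) fun q => f q.1 d * b q.2 - f q.2 d * b q.1, ?_⟩
  ext z
  have : (∃ y : ℝ, ∀ i, f i (z + y • d) ≤ b i) ↔ ∃ y : ℝ, ∀ i, f i d * y ≤ b i - f i z := by
    refine exists_congr fun y => forall_congr' fun i => ?_
    rw [map_add, map_smul, smul_eq_mul, mul_comm, le_sub_iff_add_le']
  simp only [Set.mem_ofPred_eq, this, exists_forall_mul_le_iff, Sum.forall, Sum.elim_inl,
    Sum.elim_inr, Subtype.forall, Prod.forall, LinearMap.sub_apply, LinearMap.smul_apply,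
    smul_eq_mul, sub_nonneg]
  refine and_congr_right fun _ => ?_
  constructor
  · intro h i hi j hj
    linarith [h i j hi hj]
  · intro h i j hi hj
    linarith [h i hi j hj]

theorem IsPolyhedral.exists_add_mem {S : Set E} (hS : IsPolyhedral S) {W : Submodule ℝ E}
    (hW : W.FG) : IsPolyhedral {z | ∃ w ∈ W, z + w ∈ S} := by
  classical
  obtain ⟨t, rfl⟩ := hW
  induction t using Finset.induction_on with
  | empty => simpa using hS
  | insert d t _ ih =>
    convert ih.exists_add_smul d using 3 with z
    simp only [Finset.coe_insert, Submodule.mem_span_insert, Set.mem_ofPred_eq]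
    constructor
    · rintro ⟨w, ⟨y, v, hv, rfl⟩, h⟩
      exact ⟨y, v, hv, by rwa [add_assoc]⟩
    · rintro ⟨y, v, hv, h⟩
      exact ⟨_, ⟨y, v, hv, rfl⟩, by rwa [← add_assoc]⟩

theorem IsPolyhedral.proj [Module.Finite ℝ E] {S : Set (E × F)} (hS : IsPolyhedral S) :
    IsPolyhedral {y | ∃ x, (x, y) ∈ S} := by
  have hW : (LinearMap.range (LinearMap.inl ℝ E F)).FG := by
    rw [LinearMap.range_eq_map]
    exact Module.Finite.fg_top.map _
  convert (hS.exists_add_mem hW).preimage (LinearMap.inr ℝ E F) using 3 with y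
  simp

theorem IsPolyhedral.isClosed {S : Set ℝ} (hS : IsPolyhedral S) : IsClosed S := by
  obtain ⟨ι, hι, f, b, rfl⟩ := hS
  rw [Set.ofPred_forall]
  exact isClosed_iInter fun i =>
    isClosed_le (f i).continuous_of_finiteDimensional continuous_const

end

/-- The transition relation of a statement without choices is a polyhedron. -/
theorem Stmt.isPolyhedral_rel (s : Stmt n) (σ : s.Strat) :
    IsPolyhedral {p : (Fin n → ℝ) × (Fin n → ℝ) | (s.apply σ).Rel p.1 p.2} := by
  induction s with
  | assign A b =>
    convert isPolyhedral_eq (LinearMap.snd ℝ (Fin n → ℝ) (Fin n → ℝ) -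
      A.mulVecLin ∘ₗ LinearMap.fst ℝ _ _) b using 3 with p
    simp [Stmt.apply, Stmt.Rel, sub_eq_iff_eq_add, add_comm]
  | guard k A b =>
    convert (isPolyhedral_le (A.mulVecLin ∘ₗ LinearMap.fst ℝ _ (Fin n → ℝ)) b).inter
      (isPolyhedral_eq (LinearMap.snd ℝ (Fin n → ℝ) (Fin n → ℝ) - LinearMap.fst ℝ _ _) 0)
      using 3 with p
    simp [Stmt.apply, Stmt.Rel, sub_eq_zero]
  | seq s₀ s₁ h₀ h₁ =>
    let V := Fin n → ℝ
    exact (((h₀ σ.1).preimage (((LinearMap.fst ℝ V V) ∘ₗ LinearMap.snd ℝ V (V × V)).prod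
      (LinearMap.fst ℝ V (V × V)))).inter ((h₁ σ.2).preimage ((LinearMap.fst ℝ V (V × V)).prod
      ((LinearMap.snd ℝ V V) ∘ₗ LinearMap.snd ℝ V (V × V))))).proj
  | choice s₀ s₁ h₀ h₁ =>
    simp only [Stmt.apply]
    split
    · exact h₁ _
    · exact h₀ _

/-- A finite value of a disjunct without choices is attained, since it is the supremum of the
projection of a polyhedron, a closed set of real numbers. -/
theorem Stmt.exists_of_absSem_eq (T : Matrix (Fin m) (Fin n) ℝ) {s : Stmt n} {σ : s.Strat}
    {d : Fin m → ℝ} {j : Fin m} {r : ℝ}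
    (h : (s.apply σ).absSem T (fun i => (d i : EReal)) j = r) :
    ∃ x x', T *ᵥ x ≤ d ∧ (s.apply σ).Rel x x' ∧ (T *ᵥ x') j = r := by
  let V := Fin n → ℝ
  have hpoly : IsPolyhedral
      {t : ℝ | ∃ p : V × V, (T *ᵥ p.1 ≤ d ∧ (s.apply σ).Rel p.1 p.2) ∧ (T *ᵥ p.2) j = t} := by
    have h₁ := (isPolyhedral_le (T.mulVecLin ∘ₗ LinearMap.fst ℝ V V) d).inter
      (s.isPolyhedral_rel σ)
    have h₂ := isPolyhedral_eq (LinearMap.pi fun _ : Unit => (LinearMap.proj j ∘ₗ T.mulVecLin ∘ₗ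
      LinearMap.snd ℝ V V) ∘ₗ LinearMap.fst ℝ (V × V) ℝ - LinearMap.snd ℝ (V × V) ℝ) 0
    convert ((h₁.preimage (LinearMap.fst ℝ (V × V) ℝ)).inter h₂).proj using 7 with t p
    simp [funext_iff, sub_eq_zero, V]
  have hmem : r ∈ closure
      {t : ℝ | ∃ p : V × V, (T *ᵥ p.1 ≤ d ∧ (s.apply σ).Rel p.1 p.2) ∧ (T *ᵥ p.2) j = t} := by
    refine Metric.mem_closure_iff.2 fun ε hε => ?_
    have hlt : ((r - ε : ℝ) : EReal) < (s.apply σ).absSem T (fun i => (d i : EReal)) j := by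
      rw [h]; norm_cast; linarith
    obtain ⟨x, x', hx, hxx, hr⟩ := (Stmt.lt_absSem_iff T _ _ j _).1 hlt
    have hle := Stmt.le_absSem T j hx hxx
    rw [h] at hle
    norm_cast at hr hle
    refine ⟨_, ⟨(x, x'), ⟨fun i => ?_, hxx⟩, rfl⟩, ?_⟩
    · exact EReal.coe_le_coe_iff.1 (hx i)
    · rw [Real.dist_eq, abs_lt]; constructor <;> linarith
  rw [hpoly.isClosed.closure_eq] at hmem
  obtain ⟨p, ⟨h₁, h₂⟩, h₃⟩ := hmem
  exact ⟨p.1, p.2, h₁, h₂, h₃⟩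

/-! ### Least solutions above a pre-solution -/

theorem exists_isLeastSolAbove {T : Matrix (Fin m) (Fin n) ℝ} {E : System n m X}
    {ρ : X → EReal} (hρ : ρ ≤ E.sem T ρ) : ∃ ρ', IsLeastSolAbove T E ρ ρ' :=
  ⟨(E.sem T).nextFixed ρ hρ, ⟨((E.sem T).nextFixed ρ hρ).2, (E.sem T).le_nextFixed hρ⟩,
    fun η hη => (E.sem T).nextFixed_le hρ (y := ⟨η, hη.1⟩) hη.2⟩

theorem IsLeastSolAbove.le_of_sem_le {T : Matrix (Fin m) (Fin n) ℝ} {E : System n m X}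
    {ρ ρ' w : X → EReal} (h : IsLeastSolAbove T E ρ ρ') (hρ : ρ ≤ E.sem T ρ) (hw : ρ ≤ w)
    (hw' : E.sem T w ≤ w) : ρ' ≤ w := by
  have h₁ : ρ' ≤ (E.sem T).nextFixed ρ hρ :=
    h.2 ⟨((E.sem T).nextFixed ρ hρ).2, (E.sem T).le_nextFixed hρ⟩
  exact h₁.trans ((OrderHom.const _ ρ ⊔ E.sem T).lfp_le (sup_le hw hw'))

/-! ### The invariant of the strategy improvement algorithm -/

/-- Rigidity of an assignment `ρ` for a system: no variables that are still at their finite value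
in `ρ` can be raised together in a self-supporting way, not even after other variables have been
raised (from `ρ` to `q`). -/
def Rigid (T : Matrix (Fin m) (Fin n) ℝ) (E : System n m X) (ρ : X → EReal) : Prop :=
  ∀ q z : X → EReal, ρ ≤ q → q ≤ z → (∀ x, z x < ⊤) →
    (∀ x, ⊥ < ρ x → q x = ρ x → q x < z x → E.sem T q x ≤ q x ∧ z x ≤ E.sem T z x) →
    ∀ x, ⊥ < ρ x → q x = ρ x → z x ≤ q x

/-- The invariant of the strategy improvement algorithm: `ρ` is a rigid solution of `E(σ)` without
the value `∞`, and it has the value `-∞` only where `σ` selects the constant `-∞` (the converse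
holds because `ρ` is a solution, see `Invariant.bot_lt_iff`). -/
structure Invariant (T : Matrix (Fin m) (Fin n) ℝ) (E : System n m X) (σ : Strategy E)
    (ρ : X → EReal) : Prop where
  sol : (E.apply σ).sem T ρ = ρ
  lt_top : ∀ x, ρ x < ⊤
  bot_lt : ∀ x, (E x).apply (σ x) ≠ .const ⊥ → ⊥ < ρ x
  rigid : Rigid T (E.apply σ) ρ

theorem System.sem_apply_le (T : Matrix (Fin m) (Fin n) ℝ) (E : System n m X) (σ : Strategy E)
    (ρ : X → EReal) : (E.apply σ).sem T ρ ≤ E.sem T ρ :=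
  fun x => (E x).eval_apply_le T ρ (σ x)

theorem IsImprovement.sem_le {T : Matrix (Fin m) (Fin n) ℝ} {E : System n m X}
    {σ σ' : Strategy E} {ρ : X → EReal} (h : IsImprovement T E σ ρ σ') :
    (E.apply σ).sem T ρ ≤ (E.apply σ').sem T ρ := by
  intro x
  by_cases hx : (E x).apply (σ' x) = (E x).apply (σ x)
  · simp [System.sem, System.apply, hx]
  · exact (h.profitable x hx).le

theorem IsImprovement.apply_eq {T : Matrix (Fin m) (Fin n) ℝ} {E : System n m X}
    {σ σ' : Strategy E} {ρ : X → EReal} (h : IsImprovement T E σ ρ σ') {x : X}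
    (hx : (E.apply σ').sem T ρ x ≤ (E.apply σ).sem T ρ x) :
    (E x).apply (σ' x) = (E x).apply (σ x) := by
  by_contra hne
  exact hx.not_gt (h.profitable x hne)

theorem Invariant.le_sem {T : Matrix (Fin m) (Fin n) ℝ} {E : System n m X} {σ σ' : Strategy E}
    {ρ : X → EReal} (h : Invariant T E σ ρ) (hi : IsImprovement T E σ ρ σ') :
    ρ ≤ (E.apply σ').sem T ρ :=
  h.sol.symm.le.trans hi.sem_le

theorem Invariant.bot_lt_sem {T : Matrix (Fin m) (Fin n) ℝ} {E : System n m X}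
    {σ σ' : Strategy E} {ρ : X → EReal} (h : Invariant T E σ ρ) (hi : IsImprovement T E σ ρ σ')
    {x : X} (hx : (E x).apply (σ' x) ≠ .const ⊥) : ⊥ < (E.apply σ').sem T ρ x := by
  by_cases hx' : (E x).apply (σ' x) = (E x).apply (σ x)
  · exact (h.bot_lt x (hx' ▸ hx)).trans_le (h.le_sem hi x)
  · exact bot_le.trans_lt (hi.profitable x hx')

/-- A convex combination with small weight of `z` is close to the other point. -/
theorem eventually_convex_comb_mem {a b : ℝ} {U : Set ℝ} (hU : U ∈ nhds b) :
    ∀ᶠ c : ℝ in nhdsWithin 0 (Set.Ioi 0), c * a + (1 - c) * b ∈ U := by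
  have : Filter.Tendsto (fun c : ℝ => c * a + (1 - c) * b) (nhdsWithin 0 (Set.Ioi 0))
      (nhds b) := by
    have h : Continuous fun c : ℝ => c * a + (1 - c) * b := by fun_prop
    simpa using (h.tendsto 0).mono_left nhdsWithin_le_nhds
  exact this hU

theorem eventually_div_mem {a b : ℝ} {U : Set ℝ} (hU : U ∈ nhds b) :
    ∀ᶠ c : ℝ in nhdsWithin 0 (Set.Ioi 0), (b - c * a) / (1 - c) ∈ U := by
  have : Filter.Tendsto (fun c : ℝ => (b - c * a) / (1 - c)) (nhdsWithin 0 (Set.Ioi 0))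
      (nhds b) := by
    have h : ContinuousAt (fun c : ℝ => (b - c * a) / (1 - c)) 0 := by
      apply ContinuousAt.div <;> first | fun_prop | simp
    simpa using h.tendsto.mono_left nhdsWithin_le_nhds
  exact this hU

/-- Improvement steps preserve rigidity.  If a set `A` of variables violates it for the new
assignment `ρ'`, then, by rigidity of `ρ`, the step strictly increases all variables in `A`; by
concavity, lowering these variables slightly from `ρ'`, in the direction opposite to the one in
which they can be raised, gives a post-solution above `ρ`, and `ρ'` is not the least one. -/
theorem Invariant.rigid_of_improvement [Finite X] {T : Matrix (Fin m) (Fin n) ℝ}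
    {E : System n m X} {σ σ' : Strategy E} {ρ ρ' : X → EReal} (h : Invariant T E σ ρ)
    (hi : IsImprovement T E σ ρ σ') (hl : IsLeastSolAbove T (E.apply σ') ρ ρ') :
    Rigid T (E.apply σ') ρ' := by
  classical
  intro q z hq hqz hz hA
  have hρ : ρ ≤ ρ' := hl.1.2
  have hsol : (E.apply σ').sem T ρ' = ρ' := hl.1.1
  have hold : ∀ x, ⊥ < ρ x → q x = ρ x → z x ≤ q x := by
    refine h.rigid q z (hρ.trans hq) hqz hz fun x hx hqx hlt => ?_
    have hx' : ρ' x = ρ x := le_antisymm (hqx ▸ hq x) (hρ x)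
    have happ : (E x).apply (σ' x) = (E x).apply (σ x) := by
      apply hi.apply_eq
      rw [h.sol, ← hx', ← congrFun hsol x]
      simpa only [hsol] using ((E.apply σ').sem T).monotone hρ x
    have := hA x (hx'.symm ▸ hx) (hqx.trans hx'.symm) hlt
    simpa only [System.sem, System.apply, OrderHom.coe_mk, happ] using this
  by_contra! hne
  obtain ⟨x₀, hx₀⟩ := hne
  let A : Set X := {x | ⊥ < ρ' x ∧ q x = ρ' x ∧ q x < z x}
  have hx₀A : x₀ ∈ A := hx₀
  have hρA : ∀ x ∈ A, ρ x < q x := by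
    rintro x ⟨hx, hqx, hlt⟩
    refine lt_of_le_of_ne (hqx ▸ hρ x) fun he => ?_
    exact (hold x (by rwa [he, hqx]) he.symm).not_gt hlt
  have hzcoe : ∀ x, ⊥ < ρ' x → ((z x).toReal : EReal) = z x := fun x hx =>
    EReal.coe_toReal (hz x).ne (hx.trans_le ((hq x).trans (hqz x))).ne'
  have hqcoe : ∀ x, ⊥ < ρ' x → ((q x).toReal : EReal) = q x := fun x hx =>
    EReal.coe_toReal ((hqz x).trans_lt (hz x)).ne (hx.trans_le (hq x)).ne'
  have hρcoe : ∀ x, ⊥ < ρ' x → ((ρ' x).toReal : EReal) = ρ' x := fun x hx =>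
    EReal.coe_toReal ((hq x).trans_lt ((hqz x).trans_lt (hz x))).ne hx.ne'
  -- The weight `c` is small enough for the finitely many strict inequalities that have to survive.
  have hc₁ : ∀ᶠ c : ℝ in nhdsWithin 0 (Set.Ioi 0), ∀ x, x ∈ A →
      ρ x < (((q x).toReal - c * (z x).toReal) / (1 - c) : ℝ) := by
    refine Filter.eventually_all.2 fun x => ?_
    by_cases hx : x ∈ A
    · have hU : {r : ℝ | ρ x < r} ∈ nhds (q x).toReal := by
        refine (isOpen_Ioi.preimage continuous_coe_real_ereal).mem_nhds ?_
        simpa [hqcoe x hx.1] using hρA x hx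
      filter_upwards [eventually_div_mem hU] with c hc _ using hc
    · exact Filter.Eventually.of_forall fun c hx' => absurd hx' hx
  have hc₂ : ∀ᶠ c : ℝ in nhdsWithin 0 (Set.Ioi 0), ∀ x, ⊥ < ρ' x → ρ' x < q x →
      ((c * (z x).toReal + (1 - c) * (ρ' x).toReal : ℝ) : EReal) ≤ q x := by
    refine Filter.eventually_all.2 fun x => ?_
    by_cases hx : ⊥ < ρ' x ∧ ρ' x < q x
    · have hU : {r : ℝ | (r : EReal) < q x} ∈ nhds (ρ' x).toReal := by
        refine (isOpen_Iio.preimage continuous_coe_real_ereal).mem_nhds ?_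
        simpa [hρcoe x hx.1] using hx.2
      filter_upwards [eventually_convex_comb_mem hU] with c hc _ _ using hc.le
    · exact Filter.Eventually.of_forall fun c h₁ h₂ => absurd ⟨h₁, h₂⟩ hx
  have hc₃ : ∀ᶠ c : ℝ in nhdsWithin 0 (Set.Ioi 0), c < 1 :=
    nhdsWithin_le_nhds (Iio_mem_nhds one_pos)
  obtain ⟨c, ⟨⟨hc₁, hc₂⟩, hc1⟩, hc0⟩ :=
    (((hc₁.and hc₂).and hc₃).and self_mem_nhdsWithin).exists
  have hc0 : 0 < c := hc0
  have hd0 : 0 < 1 - c := sub_pos.2 hc1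
  let v : X → ℝ := fun x => ((q x).toReal - c * (z x).toReal) / (1 - c)
  have hv : ∀ x, c * (z x).toReal + (1 - c) * v x = (q x).toReal := by
    intro x
    have : (1 - c) * v x = (q x).toReal - c * (z x).toReal := mul_div_cancel₀ _ hd0.ne'
    rw [this]; ring
  have hvq : ∀ x ∈ A, (v x : EReal) < q x := by
    intro x hx
    rw [← hqcoe x hx.1]
    have hlt := hx.2.2
    rw [← hqcoe x hx.1, ← hzcoe x hx.1] at hlt
    norm_cast at hlt ⊢
    have := hv x
    nlinarith
  let w : X → EReal := fun x => if x ∈ A then (v x : EReal) else ρ' x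
  have hwA : ∀ x ∈ A, w x = v x := fun x hx => if_pos hx
  have hwA' : ∀ x, x ∉ A → w x = ρ' x := fun x hx => if_neg hx
  have hwρ' : w ≤ ρ' := by
    intro x
    by_cases hx : x ∈ A
    · rw [hwA x hx, ← hx.2.1]; exact (hvq x hx).le
    · exact (hwA' x hx).le
  have hρw : ρ ≤ w := by
    intro x
    by_cases hx : x ∈ A
    · rw [hwA x hx]; exact (hc₁ x hx).le
    · rw [hwA' x hx]; exact hρ x
  have hcomb : ∀ x, ∀ a b : ℝ, (a : EReal) ≤ z x → (b : EReal) ≤ w x →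
      ((c * a + (1 - c) * b : ℝ) : EReal) ≤ q x := by
    intro x a b ha hb
    have hx : ⊥ < ρ' x := (EReal.bot_lt_coe b).trans_le (hb.trans (hwρ' x))
    have ha' : a ≤ (z x).toReal := by rw [← hzcoe x hx] at ha; exact_mod_cast ha
    by_cases hxA : x ∈ A
    · rw [hwA x hxA] at hb
      have hb' : b ≤ v x := by exact_mod_cast hb
      rw [← hqcoe x hx, ← hv x]
      norm_cast
      gcongr
    · rw [hwA' x hxA] at hb
      have hb' : b ≤ (ρ' x).toReal := by rw [← hρcoe x hx] at hb; exact_mod_cast hb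
      rcases (hq x).lt_or_eq with hlt | heq
      · refine le_trans ?_ (hc₂ x hx hlt)
        norm_cast
        gcongr
      · have hzq : z x ≤ q x := not_lt.1 fun hlt => hxA ⟨hx, heq.symm, hlt⟩
        rw [← hqcoe x hx] at hzq ⊢
        rw [heq] at hb'
        have ha'' : a ≤ (q x).toReal := by exact_mod_cast ha.trans hzq
        norm_cast
        nlinarith
  have hpost : (E.apply σ').sem T w ≤ w := by
    intro x
    by_cases hx : x ∈ A
    · rw [hwA x hx]
      by_contra! hlt
      obtain ⟨hq', hz'⟩ := hA x hx.1 hx.2.1 hx.2.2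
      obtain ⟨r, hr, hr'⟩ := EReal.lt_iff_exists_real_btwn.1 hlt
      have hr : v x < r := by exact_mod_cast hr
      -- The weights make the two lower bounds combine to the value `q x`.
      have hz'' : (((z x).toReal - (1 - c) * (r - v x) / c : ℝ) : EReal) <
          (E.apply σ').sem T z x := by
        refine lt_of_lt_of_le ?_ hz'
        rw [← hzcoe x hx.1]
        norm_cast
        have : 0 < (1 - c) * (r - v x) / c := div_pos (mul_pos hd0 (sub_pos.2 hr)) hc0
        simpa using this
      have := (E x).lt_eval_apply_of_convex_comb T (σ' x) hc0 hd0 (by ring) hcomb hz'' hr'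
      have he : c * ((z x).toReal - (1 - c) * (r - v x) / c) + (1 - c) * r = (q x).toReal := by
        rw [← hv x]; field_simp; ring
      rw [he, hqcoe x hx.1] at this
      exact this.not_ge hq'
    · rw [hwA' x hx]
      exact (((E.apply σ').sem T).monotone hwρ' x).trans (congrFun hsol x).le
  have := hl.le_of_sem_le (h.le_sem hi) hρw hpost x₀
  rw [hwA x₀ hx₀A, ← hx₀.2.1] at this
  exact this.not_gt (hvq x₀ hx₀A)

theorem Invariant.step [Finite X] {T : Matrix (Fin m) (Fin n) ℝ} {E : System n m X}
    {σ σ' : Strategy E} {ρ ρ' w : X → EReal} (h : Invariant T E σ ρ)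
    (hi : IsImprovement T E σ ρ σ') (hl : IsLeastSolAbove T (E.apply σ') ρ ρ') (hw : ρ' ≤ w)
    (hw' : ∀ x, w x < ⊤) : Invariant T E σ' ρ' where
  sol := hl.1.1
  lt_top x := (hw x).trans_lt (hw' x)
  bot_lt x hx := by
    have h₁ := ((E.apply σ').sem T).monotone hl.1.2 x
    rw [show (E.apply σ').sem T ρ' = ρ' from hl.1.1] at h₁
    exact (h.bot_lt_sem hi hx).trans_le h₁
  rigid := h.rigid_of_improvement hi hl

theorem Invariant.bot_lt_iff {T : Matrix (Fin m) (Fin n) ℝ} {E : System n m X}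
    {σ : Strategy E} {ρ : X → EReal} (h : Invariant T E σ ρ) {x : X} :
    ⊥ < ρ x ↔ (E x).apply (σ x) ≠ .const ⊥ := by
  refine ⟨fun hx he => ?_, h.bot_lt x⟩
  rw [← congrFun h.sol x] at hx
  simp [System.sem, System.apply, Expr.eval, he, Atom.eval] at hx

/-- The assignment maintained by the algorithm is the greatest pre-solution with its set of
variables of value `-∞`. -/
theorem Invariant.le_of_le_sem {T : Matrix (Fin m) (Fin n) ℝ} {E : System n m X}
    {σ : Strategy E} {ρ z : X → EReal} (h : Invariant T E σ ρ) (hz : ∀ x, z x < ⊤)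
    (hbot : ∀ x, ⊥ < z x → ⊥ < ρ x) (hpre : z ≤ (E.apply σ).sem T z) : z ≤ ρ := by
  intro x
  rcases eq_bot_or_bot_lt (z x) with hx | hx
  · simp [hx]
  refine le_sup_left.trans (h.rigid ρ (z ⊔ ρ) le_rfl le_sup_right
    (fun y => sup_lt_iff.2 ⟨hz y, h.lt_top y⟩) (fun y _ _ hlt => ?_) x (hbot x hx) rfl)
  refine ⟨(congrFun h.sol y).le, ?_⟩
  have hy : ρ y < z y := by simpa using hlt
  have he : (z ⊔ ρ) y = z y := sup_eq_left.2 hy.le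
  rw [he]
  exact (hpre y).trans (((E.apply σ).sem T).monotone le_sup_left y)

/-- By strictness, a disjunct with a value `> -∞` at `ρ` refers only to variables with values `> -∞`
in `ρ`. -/
theorem Atom.eval_congr (T : Matrix (Fin m) (Fin n) ℝ) {a : Atom n m X} {ρ z z' : X → EReal}
    (ha : ⊥ < a.eval T ρ) (hz : ∀ y, ⊥ < ρ y → z y = z' y) : a.eval T z = a.eval T z' := by
  cases a with
  | const c => rfl
  | abs s j args =>
    have : ∀ i, z (args i) = z' (args i) := fun i =>
      hz _ (Stmt.bot_lt_of_bot_lt_absSem T ha i)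
    simp [Atom.eval, this]

/-! ### Counting improvement steps -/

theorem System.sem_joinBot (T : Matrix (Fin m) (Fin n) ℝ) (E : System n m X) :
    E.joinBot.sem T = E.sem T := by
  ext ρ x
  exact sup_bot_eq _

theorem System.leastSol_isFixed (T : Matrix (Fin m) (Fin n) ℝ) (E : System n m X) :
    E.sem T (E.leastSol T) = E.leastSol T :=
  (E.sem T).map_lfp

theorem invariant_init (T : Matrix (Fin m) (Fin n) ℝ) (E : System n m X) :
    Invariant T E.joinBot (initStrategy E) fun _ => ⊥ where
  sol := rfl
  lt_top _ := bot_lt_top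
  bot_lt _ hx := absurd rfl hx
  rigid _ _ _ _ _ _ _ hx := absurd hx (lt_irrefl _)

theorem IsLeastSolAbove.le_leastSol {T : Matrix (Fin m) (Fin n) ℝ} {E : System n m X}
    {σ σ' : Strategy E.joinBot} {ρ ρ' : X → EReal} (h : Invariant T E.joinBot σ ρ)
    (hi : IsImprovement T E.joinBot σ ρ σ')
    (hl : IsLeastSolAbove T (E.joinBot.apply σ') ρ ρ') (hρ : ρ ≤ E.leastSol T) :
    ρ' ≤ E.leastSol T := by
  refine hl.le_of_sem_le (h.le_sem hi) hρ ((E.joinBot.sem_apply_le T σ' _).trans ?_)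
  rw [E.sem_joinBot, E.leastSol_isFixed]

theorem Reaches.invariant [Finite X] {T : Matrix (Fin m) (Fin n) ℝ} {E : System n m X}
    (hE : ∀ x, E.leastSol T x < ⊤) {k : ℕ} {σ : Strategy E.joinBot} {ρ : X → EReal}
    (h : Reaches T E k σ ρ) : Invariant T E.joinBot σ ρ ∧ ρ ≤ E.leastSol T := by
  induction h with
  | init => exact ⟨invariant_init T E, fun _ => bot_le⟩
  | step _ _ hi hl ih =>
    have hle := IsLeastSolAbove.le_leastSol ih.1 hi hl ih.2
    exact ⟨ih.1.step hi hl hle hE, hle⟩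

/-- The strategy for `E` that agrees with a strategy for `E ∨ -∞` except for an arbitrary choice
where the latter selects the additional disjunct `-∞`. -/
noncomputable def completion (E : System n m X) (σ : Strategy E.joinBot) : Strategy E :=
  fun x => Sum.elim id (fun _ => (E x).decode (fun _ => false) 0)
    (σ x : (E x).Strat ⊕ (Expr.atom (Atom.const ⊥) : Expr n m X).Strat)

theorem apply_eq_of_completion_eq {E : System n m X} {σ τ : Strategy E.joinBot} {x : X}
    (h : completion E σ x = completion E τ x) (hσ : (E.joinBot x).apply (σ x) ≠ .const ⊥)
    (hτ : (E.joinBot x).apply (τ x) ≠ .const ⊥) :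
    (E.joinBot x).apply (σ x) = (E.joinBot x).apply (τ x) := by
  simp only [completion] at h
  generalize σ x = a at *
  generalize τ x = b at *
  match a, b with
  | .inl a, .inl b => exact congrArg _ (congrArg Sum.inl h)
  | .inr a, _ => exact absurd rfl hσ
  | _, .inr b => exact absurd rfl hτ

/-- A strategy for `E` is retired at `ρ` if it is the completion of none of the strategies that
the algorithm can visit from `ρ` on. -/
def Retired (T : Matrix (Fin m) (Fin n) ℝ) (E : System n m X) (ρ : X → EReal)
    (τ : Strategy E) : Prop :=
  ∀ σ' ρ', Invariant T E.joinBot σ' ρ' → ρ ≤ ρ' → completion E σ' ≠ τ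

/-- A strategy is retired when the assignment grows on the set of variables with values `> -∞`:
on this set, the strategy determines the assignment. -/
theorem Invariant.retired {T : Matrix (Fin m) (Fin n) ℝ} {E : System n m X}
    {σ : Strategy E.joinBot} {ρ ρ' : X → EReal} (h : Invariant T E.joinBot σ ρ) (hρ : ρ ≤ ρ')
    {x : X} (hx : ⊥ < ρ x) (hlt : ρ x < ρ' x) : Retired T E ρ' (completion E σ) := by
  classical
  intro σ₁ ρ₁ h₁ hρ₁ heq
  let z : X → EReal := fun y => if ⊥ < ρ y then ρ₁ y else ⊥
  have hzpos : ∀ y, ⊥ < ρ y → z y = ρ₁ y := fun y hy => if_pos hy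
  have hzρ₁ : ∀ y, z y < ⊤ := by
    intro y
    by_cases hy : ⊥ < ρ y
    · rw [hzpos y hy]; exact h₁.lt_top y
    · simp [z, hy]
  have hz : z ≤ ρ := by
    refine h.le_of_le_sem hzρ₁ (fun y hy => ?_) fun y => ?_
    · by_contra hy'
      simp [z, hy'] at hy
    · by_cases hy : ⊥ < ρ y
      · have happ : (E.joinBot y).apply (σ₁ y) = (E.joinBot y).apply (σ y) :=
          apply_eq_of_completion_eq (congrFun heq y)
            (h₁.bot_lt_iff.1 (hy.trans_le ((hρ y).trans (hρ₁ y)))) (h.bot_lt_iff.1 hy)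
        have hev : ((E.joinBot y).apply (σ y)).eval T z = ((E.joinBot y).apply (σ y)).eval T ρ₁ :=
          Atom.eval_congr T (by rwa [← congrFun h.sol y] at hy) hzpos
        rw [hzpos y hy]
        refine le_of_eq ?_
        calc ρ₁ y = ((E.joinBot y).apply (σ₁ y)).eval T ρ₁ := (congrFun h₁.sol y).symm
          _ = ((E.joinBot y).apply (σ y)).eval T z := by rw [happ, hev]
      · simp [z, hy]
  have := hz x
  rw [hzpos x hx] at this
  exact (hlt.trans_le (hρ₁ x)).not_ge this

/-- Every step either retires another strategy or enlarges the set of variables with values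
`> -∞`. -/
theorem Reaches.exists_retired [Fintype X] {T : Matrix (Fin m) (Fin n) ℝ} {E : System n m X}
    (hE : ∀ x, E.leastSol T x < ⊤) {k : ℕ} {σ : Strategy E.joinBot} {ρ : X → EReal}
    (h : Reaches T E k σ ρ) :
    ∃ V : Set (Strategy E), (∀ τ ∈ V, Retired T E ρ τ) ∧
      k ≤ V.ncard + {x | ⊥ < ρ x}.ncard := by
  induction h with
  | init => exact ⟨∅, by simp, by simp⟩
  | @step k σ σ' ρ ρ' hr hns hi hl ih =>
    obtain ⟨V, hV, hk⟩ := ih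
    have hinv := (hr.invariant hE).1
    have hρ : ρ ≤ ρ' := hl.1.2
    have hmono : ∀ τ, Retired T E ρ τ → Retired T E ρ' τ :=
      fun τ hτ σ₁ ρ₁ h₁ h₂ => hτ σ₁ ρ₁ h₁ (hρ.trans h₂)
    have hsub : {x | ⊥ < ρ x} ⊆ {x | ⊥ < ρ' x} := fun x (hx : ⊥ < ρ x) => hx.trans_le (hρ x)
    by_cases hgrow : {x | ⊥ < ρ x} = {x | ⊥ < ρ' x}
    · have hlt : ρ < ρ' := by
        refine (hi.increase hns).trans_le ?_
        have := ((E.joinBot.apply σ').sem T).monotone hρ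
        rwa [show (E.joinBot.apply σ').sem T ρ' = ρ' from hl.1.1] at this
      obtain ⟨-, x, hx⟩ := Pi.lt_def.1 hlt
      have hx' : ⊥ < ρ x := by
        have : x ∈ {x | ⊥ < ρ' x} := bot_le.trans_lt hx
        rwa [← hgrow] at this
      have hnot : completion E σ ∉ V := fun hmem => hV _ hmem σ ρ hinv le_rfl rfl
      refine ⟨insert (completion E σ) V, ?_, ?_⟩
      · rintro τ (rfl | hτ)
        · exact hinv.retired hρ hx' hx
        · exact hmono τ (hV τ hτ)
      · rw [Set.ncard_insert_of_notMem hnot (Set.toFinite V), ← hgrow]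
        omega
    · refine ⟨V, fun τ hτ => hmono τ (hV τ hτ), ?_⟩
      have := Set.ncard_lt_ncard (hsub.ssubset_of_ne hgrow) (Set.toFinite _)
      omega

theorem Reaches.le_card [Fintype X] {T : Matrix (Fin m) (Fin n) ℝ} {E : System n m X}
    (hE : ∀ x, E.leastSol T x < ⊤) {k : ℕ} {σ : Strategy E.joinBot} {ρ : X → EReal}
    (h : Reaches T E k σ ρ) : k ≤ Nat.card (Strategy E) + Fintype.card X := by
  obtain ⟨V, -, hk⟩ := h.exists_retired hE
  have h₁ := Set.ncard_le_card V
  have h₂ := Set.ncard_le_card {x | ⊥ < ρ x}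
  rw [Nat.card_eq_fintype_card (α := X)] at h₂
  omega

/-! ### Timed computations -/

@[simp] theorem val_bind {α β : Type v} (c : Timed α) (f : α → Timed β) :
    (c >>= f).val = (f c.val).val := rfl

@[simp] theorem steps_bind {α β : Type v} (c : Timed α) (f : α → Timed β) :
    (c >>= f).steps = c.steps + (f c.val).steps := rfl

@[simp] theorem val_unitStep {α : Type v} (a : α) : (unitStep a).val = a := rfl

@[simp] theorem steps_unitStep {α : Type v} (a : α) : (unitStep a).steps = 1 := rfl

theorem eval_sumLoop {V : Type v} (z : V → ℝ) (k : ℕ) (f : Fin k → Timed (LinExpr V)) :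
    (sumLoop k f).val.eval z = ∑ i, (f i).val.eval z := by
  induction k with
  | zero => simp [sumLoop, LinExpr.eval]
  | succ k ih => simp [sumLoop, LinExpr.eval, ih, Fin.sum_univ_succ]

@[simp] theorem eval_rowExpr {V : Type v} {k : ℕ} (A : Matrix (Fin k) (Fin n) ℝ) (i : Fin k)
    (y : Fin n → V) (z : V → ℝ) :
    (rowExpr (A i) y).val.eval z = (A *ᵥ fun j => z (y j)) i := by
  simp [rowExpr, eval_sumLoop, LinExpr.eval, Matrix.mulVec, dotProduct]

@[simp] theorem eval_affExpr {V : Type v} {k : ℕ} (A : Matrix (Fin k) (Fin n) ℝ) (i : Fin k)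
    (b : ℝ) (y : Fin n → V) (z : V → ℝ) :
    (affExpr (A i) b y).val.eval z = (A *ᵥ fun j => z (y j)) i + b := by
  simp [affExpr, LinExpr.eval]

/-! ### Models of the formulas -/

@[simp] theorem models_mkTrue (I : Interp) : I.Models mkTrue.val := le_refl (0 : ℝ)

@[simp] theorem models_mkFalse (I : Interp) : ¬ I.Models mkFalse.val :=
  not_le.2 (zero_lt_one (α := ℝ))

@[simp] theorem models_mkEq (I : Interp) (e₁ e₂ : LinExpr ℕ) :
    I.Models (mkEq e₁ e₂).val ↔ e₁.eval I.real = e₂.eval I.real :=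
  le_antisymm_iff.symm

@[simp] theorem models_andLoop (I : Interp) (k : ℕ) (f : Fin k → Timed Formula) :
    I.Models (andLoop k f).val ↔ ∀ i, I.Models (f i).val := by
  induction k with
  | zero => simp [andLoop]
  | succ k ih => simp [andLoop, Interp.Models, ih, Fin.forall_fin_succ]

@[simp] theorem models_mkCase (I : Interp) (a : ℕ) (φ₀ φ₁ : Formula) :
    I.Models (mkCase a φ₀ φ₁).val ↔ if I.bool a then I.Models φ₁ else I.Models φ₀ := by
  simp [mkCase, Interp.Models]
  cases I.bool a <;> simp

@[simp] theorem models_mkLeE (I : Interp) (e : LinExpr ℕ) (d : EReal) :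
    I.Models (mkLeE e d).val ↔ ((e.eval I.real : ℝ) : EReal) ≤ d := by
  induction d with
  | bot => simp [mkLeE]
  | top => simp [mkLeE]
  | coe d => simp [mkLeE, Interp.Models, LinExpr.eval]

@[simp] theorem models_mkGtE (I : Interp) (e : LinExpr ℕ) (d : EReal) :
    I.Models (mkGtE e d).val ↔ d < ((e.eval I.real : ℝ) : EReal) := by
  rcases eq_or_ne d ⊥ with rfl | hd
  · simp [mkGtE, EReal.bot_lt_coe]
  · simp [mkGtE, hd, Interp.Models]

/-- The state that an interpretation assigns to the block of variables at `x`. -/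
def Interp.state (I : Interp) (n x : ℕ) : Fin n → ℝ := fun j => I.real (x + j)

theorem nextBool_stmtFormula (s : Stmt n) (x x' r a : ℕ) :
    (stmtFormula s x x' r a).val.nextBool = a + s.numBool := by
  induction s generalizing x x' r a with
  | assign A b => rfl
  | guard k A b => rfl
  | seq s₀ s₁ h₀ h₁ => simp [stmtFormula, Stmt.numBool, h₀, h₁]; ring
  | choice s₀ s₁ h₀ h₁ => simp [stmtFormula, Stmt.numBool, h₀, h₁]; ring

theorem le_nextReal_stmtFormula (s : Stmt n) (x x' r a : ℕ) :
    r ≤ (stmtFormula s x x' r a).val.nextReal := by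
  induction s generalizing x x' r a with
  | assign A b => exact le_rfl
  | guard k A b => exact le_rfl
  | seq s₀ s₁ h₀ h₁ => exact ((Nat.le_add_right r n).trans (h₀ ..)).trans (h₁ ..)
  | choice s₀ s₁ h₀ h₁ => exact (h₀ ..).trans (h₁ ..)

theorem models_assign_iff (A : Matrix (Fin n) (Fin n) ℝ) (b : Fin n → ℝ) (x x' r a : ℕ)
    (I : Interp) : I.Models (stmtFormula (.assign A b) x x' r a).val.formula ↔
      (Stmt.assign A b).Rel (I.state n x) (I.state n x') := by
  simp [stmtFormula, Stmt.Rel, LinExpr.eval, funext_iff, Interp.state, block]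
  rfl

theorem models_guard_iff {k : ℕ} (A : Matrix (Fin k) (Fin n) ℝ) (b : Fin k → ℝ) (x x' r a : ℕ)
    (I : Interp) : I.Models (stmtFormula (.guard k A b) x x' r a).val.formula ↔
      (Stmt.guard k A b).Rel (I.state n x) (I.state n x') := by
  simp [stmtFormula, Stmt.Rel, LinExpr.eval, funext_iff, Interp.state, block, Interp.Models,
    Pi.le_def]
  exact fun _ => Iff.rfl

/-- Soundness: a model describes a transition of the statement, along the choices that are decoded
from its Boolean variables. -/
theorem rel_of_models {I : Interp} (s : Stmt n) (x x' r a : ℕ)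
    (h : I.Models (stmtFormula s x x' r a).val.formula) :
    (s.apply (s.decode I.bool a)).Rel (I.state n x) (I.state n x') := by
  induction s generalizing x x' r a with
  | assign A b => exact (models_assign_iff A b x x' r a I).1 h
  | guard k A b => exact (models_guard_iff A b x x' r a I).1 h
  | seq s₀ s₁ h₀ h₁ =>
    simp only [stmtFormula, val_bind, val_unitStep, Interp.Models] at h
    refine ⟨I.state n r, h₀ _ _ _ _ h.1, ?_⟩
    have := h₁ _ _ _ _ h.2
    rwa [nextBool_stmtFormula] at this
  | choice s₀ s₁ h₀ h₁ =>
    simp only [stmtFormula, val_bind, val_unitStep, models_mkCase] at h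
    simp only [Stmt.apply, Stmt.decode]
    split at h
    · rename_i hb
      have := h₁ _ _ _ _ h
      rw [nextBool_stmtFormula] at this
      simpa only [hb, if_true] using this
    · rename_i hb
      have hb : I.bool a = false := by simpa using hb
      simpa only [hb, Bool.false_eq_true, if_false] using h₀ _ _ _ _ h

/-- `I` and `I'` agree on the real-valued variables below `r` and the Boolean variables below
`a`. -/
def Interp.Agree (I I' : Interp) (r a : ℕ) : Prop :=
  (∀ i < r, I.real i = I'.real i) ∧ ∀ i < a, I.bool i = I'.bool i

theorem Interp.Agree.mono {I I' : Interp} {r a r' a' : ℕ} (h : I.Agree I' r a) (hr : r' ≤ r)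
    (ha : a' ≤ a) : I.Agree I' r' a' :=
  ⟨fun i hi => h.1 i (hi.trans_le hr), fun i hi => h.2 i (hi.trans_le ha)⟩

theorem Interp.Agree.trans {I I' I'' : Interp} {r a : ℕ} (h : I.Agree I' r a)
    (h' : I'.Agree I'' r a) : I.Agree I'' r a :=
  ⟨fun i hi => (h.1 i hi).trans (h'.1 i hi), fun i hi => (h.2 i hi).trans (h'.2 i hi)⟩

theorem Interp.Agree.state_eq {I I' : Interp} {r a x : ℕ} (h : I.Agree I' r a) (hx : x + n ≤ r) :
    I.state n x = I'.state n x :=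
  funext fun j => h.1 _ (by omega)

/-- The formula of a statement contains only variables that were in use or have been allocated for
it. -/
theorem models_stmtFormula_congr {I I' : Interp} (s : Stmt n) {x x' r a : ℕ} (hx : x + n ≤ r)
    (hx' : x' + n ≤ r) (h : I.Agree I' (stmtFormula s x x' r a).val.nextReal (a + s.numBool)) :
    I.Models (stmtFormula s x x' r a).val.formula ↔
      I'.Models (stmtFormula s x x' r a).val.formula := by
  induction s generalizing x x' r a with
  | assign A b =>
    rw [models_assign_iff, models_assign_iff, h.state_eq hx, h.state_eq hx']
  | guard k A b =>
    rw [models_guard_iff, models_guard_iff, h.state_eq hx, h.state_eq hx']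
  | seq s₀ s₁ h₀ h₁ =>
    simp only [stmtFormula, val_bind, val_unitStep, Interp.Models, Stmt.numBool] at h ⊢
    have hle := le_nextReal_stmtFormula s₀ x r (r + n) a
    rw [h₀ (by omega) (by omega) (h.mono (le_nextReal_stmtFormula ..) (by omega)),
      h₁ (by omega) (by omega) (h.mono le_rfl (by rw [nextBool_stmtFormula]; omega))]
  | choice s₀ s₁ h₀ h₁ =>
    simp only [stmtFormula, val_bind, val_unitStep, models_mkCase, Stmt.numBool] at h ⊢
    have hle := le_nextReal_stmtFormula s₀ x x' r (a + 1)
    rw [h₀ (by omega) (by omega) (h.mono (le_nextReal_stmtFormula ..) (by omega)),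
      h₁ (by omega) (by omega) (h.mono le_rfl (by rw [nextBool_stmtFormula]; omega)),
      h.2 a (by omega)]

/-- The interpretation `I` with the state `y` in the block at `x`. -/
def Interp.setState (I : Interp) (x : ℕ) (y : Fin n → ℝ) : Interp where
  real i := if h : x ≤ i ∧ i < x + n then y ⟨i - x, by omega⟩ else I.real i
  bool := I.bool

/-- The interpretation `I` with the value `p` for the Boolean variable `a`. -/
def Interp.setBool (I : Interp) (a : ℕ) (p : Bool) : Interp where
  real := I.real
  bool := Function.update I.bool a p

@[simp] theorem Interp.state_setState (I : Interp) (x : ℕ) (y : Fin n → ℝ) :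
    (I.setState x y).state n x = y := by
  ext j
  simp [Interp.state, Interp.setState]

theorem Interp.agree_setState (I : Interp) (x a : ℕ) (y : Fin n → ℝ) :
    I.Agree (I.setState x y) x a :=
  ⟨fun i hi => by simp [Interp.setState, hi.not_ge], fun _ _ => rfl⟩

theorem Interp.agree_setBool (I : Interp) (r a : ℕ) (p : Bool) : I.Agree (I.setBool a p) r a :=
  ⟨fun _ _ => rfl, fun i hi => by simp [Interp.setBool, hi.ne]⟩

/-- Completeness: every transition of the statement is described by a model, in which only fresh
variables have new values. -/
theorem exists_models_of_rel (s : Stmt n) {x x' r a : ℕ} (hx : x + n ≤ r) (hx' : x' + n ≤ r)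
    (I : Interp) (h : s.Rel (I.state n x) (I.state n x')) :
    ∃ I' : Interp, I.Agree I' r a ∧ I'.Models (stmtFormula s x x' r a).val.formula := by
  induction s generalizing x x' r a I with
  | assign A b => exact ⟨I, ⟨fun _ _ => rfl, fun _ _ => rfl⟩, (models_assign_iff ..).2 h⟩
  | guard k A b => exact ⟨I, ⟨fun _ _ => rfl, fun _ _ => rfl⟩, (models_guard_iff ..).2 h⟩
  | seq s₀ s₁ h₀ h₁ =>
    obtain ⟨y, hy, hy'⟩ := h
    have hle := le_nextReal_stmtFormula s₀ x r (r + n) a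
    have hI := I.agree_setState r a y
    obtain ⟨I₀, hI₀, hm₀⟩ := h₀ (x := x) (x' := r) (r := r + n) (a := a) (by omega) (by omega)
      (I.setState r y) (by rwa [Interp.state_setState, ← hI.state_eq hx])
    have hI₀' := hI.trans (hI₀.mono (Nat.le_add_right r n) le_rfl)
    obtain ⟨I₁, hI₁, hm₁⟩ := h₁ (x := r) (x' := x')
      (r := (stmtFormula s₀ x r (r + n) a).val.nextReal)
      (a := (stmtFormula s₀ x r (r + n) a).val.nextBool) (by omega) (by omega) I₀
      (by rwa [← hI₀.state_eq le_rfl, Interp.state_setState, ← hI₀'.state_eq hx'])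
    refine ⟨I₁, hI₀'.trans (hI₁.mono (by omega) (by rw [nextBool_stmtFormula]; omega)), ?_, hm₁⟩
    rw [nextBool_stmtFormula] at hI₁
    exact (models_stmtFormula_congr s₀ (by omega) (by omega) hI₁).1 hm₀
  | choice s₀ s₁ h₀ h₁ =>
    simp only [stmtFormula, val_bind, val_unitStep, models_mkCase]
    rcases h with h | h
    · have hI := I.agree_setBool r a false
      obtain ⟨I₀, hI₀, hm₀⟩ := h₀ (a := a + 1) hx hx' (I.setBool a false) h
      refine ⟨I₀, hI.trans (hI₀.mono le_rfl (by omega)), ?_⟩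
      have hb : I₀.bool a = false := by
        rw [← hI₀.2 a (by omega)]; simp [Interp.setBool]
      simpa [hb] using hm₀
    · have hI := I.agree_setBool r a true
      have hle := le_nextReal_stmtFormula s₀ x x' r (a + 1)
      obtain ⟨I₁, hI₁, hm₁⟩ := h₁ (r := (stmtFormula s₀ x x' r (a + 1)).val.nextReal)
        (a := (stmtFormula s₀ x x' r (a + 1)).val.nextBool) (by omega) (by omega)
        (I.setBool a true) h
      rw [nextBool_stmtFormula] at hI₁
      refine ⟨I₁, hI.trans (hI₁.mono hle (by omega)), ?_⟩
      have hb : I₁.bool a = true := by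
        rw [← hI₁.2 a (by omega)]; simp [Interp.setBool]
      simpa [hb] using hm₁

theorem models_abs_iff (T : Matrix (Fin m) (Fin n) ℝ) (ρ : X → EReal) (s : Stmt n) (j : Fin m)
    (args : Fin m → X) (r a : ℕ) (I : Interp) :
    I.Models (atomFormula T ρ (.abs s j args) r a).val.formula ↔
      I.state n r ∈ conc T (fun i => ρ (args i)) ∧
      I.Models (stmtFormula s r (r + n) (r + n + n) a).val.formula ∧
      I.real 0 = (T *ᵥ I.state n (r + n)) j := by
  simp [atomFormula, Interp.Models, LinExpr.eval, conc, block]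
  rfl

theorem nextBool_exprFormula (T : Matrix (Fin m) (Fin n) ℝ) (ρ : X → EReal) (e : Expr n m X)
    (r a : ℕ) : (exprFormula T ρ e r a).val.nextBool = a + e.numBool := by
  induction e generalizing r a with
  | atom α =>
    cases α with
    | const c => rfl
    | abs s j args => exact nextBool_stmtFormula ..
  | sup e₀ e₁ h₀ h₁ => simp [exprFormula, Expr.numBool, h₀, h₁]; ring

theorem le_nextReal_exprFormula (T : Matrix (Fin m) (Fin n) ℝ) (ρ : X → EReal) (e : Expr n m X)
    (r a : ℕ) : r ≤ (exprFormula T ρ e r a).val.nextReal := by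
  induction e generalizing r a with
  | atom α =>
    cases α with
    | const c => exact le_rfl
    | abs s j args =>
      exact (show r ≤ r + n + n by omega).trans (le_nextReal_stmtFormula s r (r + n) (r + n + n) a)
  | sup e₀ e₁ h₀ h₁ => exact (h₀ ..).trans (h₁ ..)

theorem le_eval_of_models {I : Interp} (T : Matrix (Fin m) (Fin n) ℝ) (ρ : X → EReal)
    (e : Expr n m X) (r a : ℕ) (h : I.Models (exprFormula T ρ e r a).val.formula) :
    (I.real 0 : EReal) ≤ (e.apply (e.decode I.bool a)).eval T ρ := by
  induction e generalizing r a with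
  | atom α =>
    cases α with
    | const c =>
      simpa [exprFormula, atomFormula, LinExpr.eval, Expr.apply, Atom.apply, Atom.eval] using h
    | abs s j args =>
      obtain ⟨h₁, h₂, h₃⟩ := (models_abs_iff T ρ s j args r a I).1 h
      rw [h₃]
      exact Stmt.le_absSem T j h₁ (rel_of_models s _ _ _ _ h₂)
  | sup e₀ e₁ h₀ h₁ =>
    simp only [exprFormula, val_bind, val_unitStep, models_mkCase] at h
    split at h
    · rename_i hb
      have hd : (Expr.sup e₀ e₁).decode I.bool a =
        Sum.inr (e₁.decode I.bool (a + 1 + e₀.numBool)) := if_pos hb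
      have := h₁ _ _ h
      rw [nextBool_exprFormula] at this
      rw [hd]
      exact this
    · rename_i hb
      have hd : (Expr.sup e₀ e₁).decode I.bool a = Sum.inl (e₀.decode I.bool (a + 1)) :=
        if_neg hb
      rw [hd]
      exact h₀ _ _ h

theorem exists_models_of_lt_eval (T : Matrix (Fin m) (Fin n) ℝ) (ρ : X → EReal) (e : Expr n m X)
    {r a : ℕ} (hr : 1 ≤ r) (β : ℕ → Bool) {c : EReal} (h : c < e.eval T ρ) :
    ∃ I : Interp, c < I.real 0 ∧ (∀ i < a, I.bool i = β i) ∧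
      I.Models (exprFormula T ρ e r a).val.formula := by
  induction e generalizing r a β with
  | atom α =>
    cases α with
    | const d =>
      obtain ⟨v, hv, hv'⟩ := EReal.lt_iff_exists_real_btwn.1 h
      refine ⟨⟨fun _ => v, β⟩, hv, fun _ _ => rfl, ?_⟩
      have hv' : (v : EReal) ≤ d := hv'.le
      simpa [exprFormula, atomFormula, LinExpr.eval] using hv'
    | abs s j args =>
      obtain ⟨y, y', hy, hyy, hc⟩ := (Stmt.lt_absSem_iff T s _ j c).1 h
      let I₀ : Interp := ⟨fun _ => (T *ᵥ y') j, β⟩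
      have h₁ := I₀.agree_setState r a y
      have h₂ := (I₀.setState r y).agree_setState (r + n) a y'
      obtain ⟨I, hI, hm⟩ := exists_models_of_rel s (x := r) (x' := r + n) (r := r + n + n) (a := a)
        (by omega) le_rfl ((I₀.setState r y).setState (r + n) y')
        (by rwa [Interp.state_setState, ← h₂.state_eq le_rfl, Interp.state_setState])
      have hy₁ : I.state n r = y := by
        rw [← hI.state_eq (by omega), ← h₂.state_eq le_rfl, Interp.state_setState]
      have hy₂ : I.state n (r + n) = y' := by
        rw [← hI.state_eq le_rfl, Interp.state_setState]
      have h0 : I.real 0 = (T *ᵥ y') j := by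
        rw [← hI.1 0 (by omega), ← h₂.1 0 (by omega), ← h₁.1 0 (by omega)]
      exact ⟨I, by rwa [h0], fun i hi => (hI.2 i hi).symm, (models_abs_iff T ρ s j args r a I).2
        ⟨by rwa [hy₁], hm, by rw [h0, hy₂]⟩⟩
  | sup e₀ e₁ h₀ h₁ =>
    simp only [exprFormula, val_bind, val_unitStep, models_mkCase]
    rcases lt_sup_iff.1 h with h | h
    · obtain ⟨I, hc, hI, hm⟩ := h₀ (a := a + 1) hr (Function.update β a false) h
      refine ⟨I, hc, fun i hi => ?_, ?_⟩
      · rw [hI i (by omega), Function.update_of_ne hi.ne]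
      · have : I.bool a = false := by rw [hI a (by omega), Function.update_self]
        simpa [this] using hm
    · obtain ⟨I, hc, hI, hm⟩ := h₁ (r := (exprFormula T ρ e₀ r (a + 1)).val.nextReal)
        (a := (exprFormula T ρ e₀ r (a + 1)).val.nextBool)
        (hr.trans (le_nextReal_exprFormula ..)) (Function.update β a true) h
      rw [nextBool_exprFormula] at hI
      refine ⟨I, hc, fun i hi => ?_, ?_⟩
      · rw [hI i (by omega), Function.update_of_ne hi.ne]
      · have : I.bool a = true := by rw [hI a (by omega), Function.update_self]
        simpa [this] using hm

theorem models_improveFormula_iff (T : Matrix (Fin m) (Fin n) ℝ) (e : Expr n m X) (ρ : X → EReal)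
    (c : EReal) (I : Interp) : I.Models (improveFormula T e ρ c).val ↔
      I.Models (exprFormula T ρ e 1 0).val.formula ∧ c < I.real 0 := by
  simp [improveFormula, Interp.Models, LinExpr.eval]

theorem exists_isAnswer (φ : Formula) : ∃ a, IsAnswer φ a := by
  by_cases h : ∃ I : Interp, I.Models φ
  · obtain ⟨I, hI⟩ := h
    exact ⟨some I, hI⟩
  · exact ⟨none, not_exists.1 h⟩

/-- Variables without a model keep their strategy, and the others get a disjunct of strictly larger
value; if no formula had a model, `ρ` would be a solution. -/
theorem isImprovement_nextStrategy {T : Matrix (Fin m) (Fin n) ℝ} {E : System n m X}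
    {σ : Strategy E} {ρ : X → EReal} (hσ : (E.apply σ).sem T ρ = ρ) {ans : X → Option Interp}
    (hans : ∀ x, IsAnswer (improveFormula T (E x) ρ (ρ x)).val (ans x)) :
    IsImprovement T E σ ρ (nextStrategy E σ ans) := by
  have hev : ∀ x, ((E x).apply (σ x)).eval T ρ = ρ x := congrFun hσ
  have hnone : ∀ x, ans x = none →
      (E x).apply (nextStrategy E σ ans x) = (E x).apply (σ x) := by
    intro x hx
    simp [nextStrategy, hx]
  have hsome : ∀ x I, ans x = some I →
      ρ x < ((E x).apply (nextStrategy E σ ans x)).eval T ρ := by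
    intro x I hx
    have hI : I.Models (improveFormula T (E x) ρ (ρ x)).val := by
      have := hans x
      rwa [hx] at this
    rw [models_improveFormula_iff] at hI
    simp only [nextStrategy, hx]
    exact hI.2.trans_le (le_eval_of_models T ρ (E x) 1 0 hI.1)
  have hle : ρ ≤ (E.apply (nextStrategy E σ ans)).sem T ρ := by
    intro x
    cases hx : ans x with
    | none =>
      exact (hev x).symm.le.trans (congrArg (fun a : Atom n m X => a.eval T ρ) (hnone x hx)).ge
    | some I => exact (hsome x I hx).le
  refine ⟨fun hns => Pi.lt_def.2 ⟨hle, ?_⟩, fun x hne => ?_⟩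
  · obtain ⟨x, hx⟩ := Function.ne_iff.1 hns
    have hlt : ρ x < (E x).eval T ρ := by
      refine lt_of_le_of_ne ?_ (Ne.symm hx)
      exact (hev x).symm.le.trans ((E x).eval_apply_le T ρ (σ x))
    obtain ⟨I, hI, -, hm⟩ := exists_models_of_lt_eval T ρ (E x) (r := 1) (a := 0) le_rfl
      (fun _ => false) hlt
    refine ⟨x, ?_⟩
    cases ha : ans x with
    | none =>
      have := hans x
      rw [ha] at this
      exact absurd ((models_improveFormula_iff T (E x) ρ (ρ x) I).2 ⟨hm, hI⟩) (this I)
    | some J => exact hsome x J ha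
  · cases ha : ans x with
    | none => exact absurd (hnone x ha) hne
    | some I => rw [hev x]; exact hsome x I ha

/-! ### Solutions of the linear programs -/

theorem forall_mem_consLoop {P : Constr X → Prop} (k : ℕ) (f : Fin k → Timed (Constr X))
    (L : List (Constr X)) :
    (∀ c ∈ (consLoop k f L).val, P c) ↔ (∀ i, P (f i).val) ∧ ∀ c ∈ L, P c := by
  induction k with
  | zero => simp [consLoop]
  | succ k ih =>
    simp only [consLoop, val_bind, val_unitStep, List.forall_mem_cons, ih, Fin.forall_fin_succ,
      and_assoc]

/-- `z` satisfies the constraints generated so far. -/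
def LPState.Sat (S : LPState X) (z : LPVar X → ℝ) : Prop :=
  ∀ c ∈ S.constraints, c.1.eval z ≤ c.2.eval z

/-- The state that a solution assigns to the block of auxiliary variables at `r`. -/
def auxState (z : LPVar X → ℝ) (n r : ℕ) : Fin n → ℝ := fun j => z (.inr (r + j))

/-- `z` and `z'` agree on the variables of the system and the auxiliary variables below `r`. -/
def AgreeBelow (z z' : LPVar X → ℝ) (r : ℕ) : Prop :=
  (∀ x, z (.inl x) = z' (.inl x)) ∧ ∀ i < r, z (.inr i) = z' (.inr i)

theorem AgreeBelow.mono {z z' : LPVar X → ℝ} {r r' : ℕ} (h : AgreeBelow z z' r) (hr : r' ≤ r) :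
    AgreeBelow z z' r' :=
  ⟨h.1, fun i hi => h.2 i (hi.trans_le hr)⟩

theorem AgreeBelow.trans {z z' z'' : LPVar X → ℝ} {r : ℕ} (h : AgreeBelow z z' r)
    (h' : AgreeBelow z' z'' r) : AgreeBelow z z'' r :=
  ⟨fun x => (h.1 x).trans (h'.1 x), fun i hi => (h.2 i hi).trans (h'.2 i hi)⟩

theorem AgreeBelow.auxState_eq {z z' : LPVar X → ℝ} {r x : ℕ} (h : AgreeBelow z z' r)
    (hx : x + n ≤ r) : auxState z n x = auxState z' n x :=
  funext fun j => h.2 _ (by omega)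

/-- The generated constraints contain no auxiliary variables that are still unused. -/
def LPState.Closed (S : LPState X) : Prop :=
  ∀ z z', AgreeBelow z z' S.next → S.Sat z → S.Sat z'

/-- The solution `z` with the state `y` in the block of auxiliary variables at `r`. -/
def setAux (z : LPVar X → ℝ) (r : ℕ) (y : Fin n → ℝ) : LPVar X → ℝ
  | .inl x => z (.inl x)
  | .inr i => if h : r ≤ i ∧ i < r + n then y ⟨i - r, by omega⟩ else z (.inr i)

@[simp] theorem auxState_setAux (z : LPVar X → ℝ) (r : ℕ) (y : Fin n → ℝ) :
    auxState (setAux z r y) n r = y := by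
  ext j
  simp [auxState, setAux]

theorem agreeBelow_setAux (z : LPVar X → ℝ) (r : ℕ) (y : Fin n → ℝ) :
    AgreeBelow z (setAux z r y) r :=
  ⟨fun _ => rfl, fun i hi => by simp [setAux, hi.not_ge]⟩

theorem sat_assign_iff (A : Matrix (Fin n) (Fin n) ℝ) (b : Fin n → ℝ)
    (σ : (Stmt.assign A b).Strat) (x x' : ℕ) (S : LPState X) (z : LPVar X → ℝ) :
    (stmtConstr (.assign A b) σ x x' S).val.Sat z ↔
      S.Sat z ∧ (Stmt.assign A b).Rel (auxState z n x) (auxState z n x') := by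
  simp only [stmtConstr, val_bind, val_unitStep, LPState.Sat, forall_mem_consLoop, eval_affExpr,
    LinExpr.eval, Stmt.Rel, le_antisymm_iff]
  exact ⟨fun h => ⟨h.2.2, h.2.1, h.1⟩, fun h => ⟨h.2.2, h.2.1, h.1⟩⟩

theorem sat_guard_iff {k : ℕ} (A : Matrix (Fin k) (Fin n) ℝ) (b : Fin k → ℝ)
    (σ : (Stmt.guard k A b).Strat) (x x' : ℕ) (S : LPState X) (z : LPVar X → ℝ) :
    (stmtConstr (.guard k A b) σ x x' S).val.Sat z ↔
      S.Sat z ∧ (Stmt.guard k A b).Rel (auxState z n x) (auxState z n x') := by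
  simp only [stmtConstr, val_bind, val_unitStep, LPState.Sat, forall_mem_consLoop, eval_rowExpr,
    LinExpr.eval, Stmt.Rel, Pi.le_def, le_antisymm_iff]
  exact ⟨fun h => ⟨h.2.2.2, h.2.2.1, h.2.1, h.1⟩, fun h => ⟨h.2.2.2, h.2.2.1, h.2.1, h.1⟩⟩

theorem next_le_stmtConstr (s : Stmt n) (σ : s.Strat) (x x' : ℕ) (S : LPState X) :
    S.next ≤ (stmtConstr s σ x x' S).val.next := by
  induction s generalizing x x' S with
  | assign A b => exact le_rfl
  | guard k A b => exact le_rfl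
  | seq s₀ s₁ h₀ h₁ =>
    exact ((Nat.le_add_right S.next n).trans
      (h₀ σ.1 x S.next ⟨S.objective, S.constraints, S.next + n⟩)).trans (h₁ ..)
  | choice s₀ s₁ h₀ h₁ =>
    simp only [stmtConstr, val_bind, val_unitStep]
    split
    · exact h₁ ..
    · exact h₀ ..

theorem objective_stmtConstr (s : Stmt n) (σ : s.Strat) (x x' : ℕ) (S : LPState X) :
    (stmtConstr s σ x x' S).val.objective = S.objective := by
  induction s generalizing x x' S with
  | assign A b => rfl
  | guard k A b => rfl
  | seq s₀ s₁ h₀ h₁ => simp [stmtConstr, h₀, h₁]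
  | choice s₀ s₁ h₀ h₁ =>
    simp only [stmtConstr, val_bind, val_unitStep]
    split
    · exact h₁ ..
    · exact h₀ ..

theorem rel_of_sat_stmtConstr {s : Stmt n} {σ : s.Strat} {x x' : ℕ} {S : LPState X}
    {z : LPVar X → ℝ} (h : (stmtConstr s σ x x' S).val.Sat z) :
    S.Sat z ∧ (s.apply σ).Rel (auxState z n x) (auxState z n x') := by
  induction s generalizing x x' S with
  | assign A b => exact (sat_assign_iff ..).1 h
  | guard k A b => exact (sat_guard_iff ..).1 h
  | seq s₀ s₁ h₀ h₁ =>
    obtain ⟨h, hr⟩ := h₁ h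
    obtain ⟨h, hr'⟩ := h₀ h
    exact ⟨h, _, hr', hr⟩
  | choice s₀ s₁ h₀ h₁ =>
    simp only [stmtConstr, val_bind, val_unitStep] at h
    simp only [Stmt.apply]
    split at h
    · rename_i hb
      simpa only [hb, if_true] using h₁ h
    · rename_i hb
      have hb : σ.1 = false := by simpa using hb
      simpa only [hb, Bool.false_eq_true, if_false] using h₀ h

theorem LPState.Closed.stmtConstr {s : Stmt n} {σ : s.Strat} {x x' : ℕ} {S : LPState X}
    (hS : S.Closed) (hx : x + n ≤ S.next) (hx' : x' + n ≤ S.next) :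
    (stmtConstr s σ x x' S).val.Closed := by
  induction s generalizing x x' S with
  | assign A b =>
    intro z z' hz h
    rw [sat_assign_iff] at h ⊢
    have hz : AgreeBelow z z' S.next := hz
    rw [← hz.auxState_eq hx, ← hz.auxState_eq hx']
    exact ⟨hS z z' hz h.1, h.2⟩
  | guard k A b =>
    intro z z' hz h
    rw [sat_guard_iff] at h ⊢
    have hz : AgreeBelow z z' S.next := hz
    rw [← hz.auxState_eq hx, ← hz.auxState_eq hx']
    exact ⟨hS z z' hz h.1, h.2⟩
  | seq s₀ s₁ h₀ h₁ =>
    let S₀ : LPState X := ⟨S.objective, S.constraints, S.next + n⟩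
    have hS₀ : S₀.Closed := fun z z' hz h => hS z z' (hz.mono (Nat.le_add_right _ _)) h
    have hle := next_le_stmtConstr s₀ σ.1 x S.next S₀
    have hn : S₀.next = S.next + n := rfl
    exact h₁ (σ := σ.2) (S := (TemplateAnalysis.stmtConstr s₀ σ.1 x S.next S₀).val)
      (h₀ (S := S₀) hS₀ (by omega) (by omega)) (by omega) (by omega)
  | choice s₀ s₁ h₀ h₁ =>
    simp only [TemplateAnalysis.stmtConstr, val_bind, val_unitStep]
    split
    · exact h₁ hS hx hx'
    · exact h₀ hS hx hx'

theorem exists_sat_stmtConstr {s : Stmt n} {σ : s.Strat} {x x' : ℕ} {S : LPState X}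
    (hS : S.Closed) (hx : x + n ≤ S.next) (hx' : x' + n ≤ S.next) {z : LPVar X → ℝ}
    (hz : S.Sat z) (h : (s.apply σ).Rel (auxState z n x) (auxState z n x')) :
    ∃ z', AgreeBelow z z' S.next ∧ (stmtConstr s σ x x' S).val.Sat z' := by
  induction s generalizing x x' S z with
  | assign A b => exact ⟨z, ⟨fun _ => rfl, fun _ _ => rfl⟩, (sat_assign_iff ..).2 ⟨hz, h⟩⟩
  | guard k A b => exact ⟨z, ⟨fun _ => rfl, fun _ _ => rfl⟩, (sat_guard_iff ..).2 ⟨hz, h⟩⟩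
  | seq s₀ s₁ h₀ h₁ =>
    obtain ⟨y, hy, hy'⟩ := h
    let S₀ : LPState X := ⟨S.objective, S.constraints, S.next + n⟩
    have hS₀ : S₀.Closed := fun z z' hz h => hS z z' (hz.mono (Nat.le_add_right _ _)) h
    have hle := next_le_stmtConstr s₀ σ.1 x S.next S₀
    have hn : S₀.next = S.next + n := rfl
    have ha := agreeBelow_setAux z S.next y
    obtain ⟨z₀, hz₀, hs₀⟩ := h₀ (σ := σ.1) (x := x) (x' := S.next) (S := S₀) hS₀ (by omega)
      (by omega) (z := setAux z S.next y) (hS z _ ha hz)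
      (by rwa [auxState_setAux, ← ha.auxState_eq hx])
    have ha₀ := ha.trans (hz₀.mono (Nat.le_add_right S.next n))
    obtain ⟨z₁, hz₁, hs₁⟩ := h₁ (σ := σ.2) (x := S.next) (x' := x')
      (S := (stmtConstr s₀ σ.1 x S.next S₀).val)
      (hS₀.stmtConstr (by omega) (by omega)) (by omega) (by omega) hs₀
      (by rwa [← hz₀.auxState_eq le_rfl, auxState_setAux, ← ha₀.auxState_eq hx'])
    exact ⟨z₁, ha₀.trans (hz₁.mono (by omega)), hs₁⟩
  | choice s₀ s₁ h₀ h₁ =>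
    simp only [stmtConstr, val_bind, val_unitStep]
    simp only [Stmt.apply] at h
    split at h
    · rename_i hb
      rw [if_pos hb]
      exact h₁ hS hx hx' hz h
    · rename_i hb
      rw [if_neg hb]
      exact h₀ hS hx hx' hz h

/-- The assignment `w` of real numbers supports the lower bound `r` of the value of a disjunct by a
witness. -/
def Atom.Supports (T : Matrix (Fin m) (Fin n) ℝ) (w : X → ℝ) (r : ℝ) : Atom n m X → Prop
  | .const c => (r : EReal) ≤ c
  | .abs s j args => ∃ y y', T *ᵥ y ≤ (fun i => w (args i)) ∧ s.Rel y y' ∧ r ≤ (T *ᵥ y') j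

theorem Atom.Supports.le_eval {T : Matrix (Fin m) (Fin n) ℝ} {w : X → ℝ} {r : ℝ}
    {a : Atom n m X} (h : a.Supports T w r) : (r : EReal) ≤ a.eval T fun x => (w x : EReal) := by
  cases a with
  | const c => exact h
  | abs s j args =>
    obtain ⟨y, y', hy, hyy, hr⟩ := h
    exact (EReal.coe_le_coe_iff.2 hr).trans
      (Stmt.le_absSem T j (fun i => EReal.coe_le_coe_iff.2 (hy i)) hyy)

theorem Expr.supports_of_eval_eq {T : Matrix (Fin m) (Fin n) ℝ} {w : X → ℝ} {r : ℝ}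
    {e : Expr n m X} {σ : e.Strat} (h : (e.apply σ).eval T (fun x => (w x : EReal)) = r) :
    (e.apply σ).Supports T w r := by
  induction e with
  | atom a =>
    cases a with
    | const c => exact h.ge
    | abs s j args =>
      obtain ⟨y, y', hy, hyy, hr⟩ := Stmt.exists_of_absSem_eq T h
      exact ⟨y, y', hy, hyy, hr.ge⟩
  | sup e₀ e₁ h₀ h₁ =>
    cases σ with
    | inl σ => exact h₀ h
    | inr σ => exact h₁ h

/-- What the linear program builder does for one equation, with `a` the selected disjunct for
`x`. -/
structure LPStep (T : Matrix (Fin m) (Fin n) ℝ) (x : X) (a : Atom n m X)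
    (S S' : LPState X) : Prop where
  closed : S.Closed → S'.Closed
  sound : ∀ z, S'.Sat z → S.Sat z ∧
    (a ≠ .const ⊥ → a.Supports T (fun y => z (.inl y)) (z (.inl x)))
  complete : S.Closed → ∀ z, S.Sat z →
    (a ≠ .const ⊥ → a.Supports T (fun y => z (.inl y)) (z (.inl x))) →
    ∃ z', (∀ y, z (.inl y) = z' (.inl y)) ∧ S'.Sat z'
  objective : ∀ z, (a = .const ⊥ → S'.objective.eval z = S.objective.eval z) ∧
    (a ≠ .const ⊥ → S'.objective.eval z = z (.inl x) + S.objective.eval z)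

theorem lpStep_const (T : Matrix (Fin m) (Fin n) ℝ) (x : X) (c : EReal)
    (σ : (Atom.const c : Atom n m X).Strat) (S : LPState X) :
    LPStep T x (.const c) S (atomConstr T x (.const c) σ S).val := by
  induction c with
  | bot =>
    simp only [atomConstr, if_true, val_unitStep]
    exact ⟨id, fun z h => ⟨h, fun h => absurd rfl h⟩, fun _ z h _ => ⟨z, fun _ => rfl, h⟩,
      fun z => ⟨fun _ => rfl, fun h => absurd rfl h⟩⟩
  | top =>
    have hne : (Atom.const ⊤ : Atom n m X) ≠ .const ⊥ := by simp
    simp only [atomConstr, val_unitStep, top_ne_bot, if_false, if_true, val_bind]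
    exact ⟨id, fun z h => ⟨h, fun _ => le_top⟩, fun _ z h _ => ⟨z, fun _ => rfl, h⟩,
      fun z => ⟨fun h => absurd h hne, fun _ => rfl⟩⟩
  | coe c =>
    have hne : (Atom.const (c : EReal) : Atom n m X) ≠ .const ⊥ := by simp
    have hsat : ∀ z, (atomConstr T x (.const c) σ S).val.Sat z ↔ z (.inl x) ≤ c ∧ S.Sat z := by
      simp [atomConstr, LPState.Sat, LinExpr.eval]
    have hnext : (atomConstr T x (.const c) σ S).val.next = S.next := by simp [atomConstr]
    refine ⟨fun hS z z' hz h => ?_, fun z h => ?_, fun _ z h hs => ⟨z, fun _ => rfl, ?_⟩,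
      fun z => ⟨fun h => absurd h hne, fun _ => ?_⟩⟩
    · rw [hnext] at hz
      rw [hsat] at h ⊢
      rw [← hz.1 x]
      exact ⟨h.1, hS z z' hz h.2⟩
    · rw [hsat] at h
      exact ⟨h.2, fun _ => EReal.coe_le_coe_iff.2 h.1⟩
    · rw [hsat]
      exact ⟨EReal.coe_le_coe_iff.1 (hs hne), h⟩
    · simp [atomConstr, LinExpr.eval]

theorem lpStep_abs (T : Matrix (Fin m) (Fin n) ℝ) (x : X) (s : Stmt n) (j : Fin m)
    (args : Fin m → X) (σ : s.Strat) (S : LPState X) :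
    LPStep T x (.abs (s.apply σ) j args) S (atomConstr T x (.abs s j args) σ S).val := by
  have hne : (Atom.abs (s.apply σ) j args : Atom n m X) ≠ .const ⊥ := by simp
  obtain ⟨S', hS', hnext, hobj, hsat⟩ : ∃ S' : LPState X,
      (atomConstr T x (.abs s j args) σ S).val =
        (stmtConstr s σ S.next (S.next + n) S').val ∧ S'.next = S.next + n + n ∧
      (∀ z, S'.objective.eval z = z (.inl x) + S.objective.eval z) ∧
      ∀ z, S'.Sat z ↔ z (.inl x) ≤ (T *ᵥ auxState z n (S.next + n)) j ∧
        T *ᵥ auxState z n S.next ≤ (fun i => z (.inl (args i))) ∧ S.Sat z := by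
    refine ⟨_, rfl, rfl, fun z => rfl, fun z => ?_⟩
    simp only [LPState.Sat, List.forall_mem_cons, val_bind, val_unitStep, forall_mem_consLoop,
      eval_rowExpr, LinExpr.eval]
    rfl
  rw [hS']
  have hcl : S.Closed → S'.Closed := by
    intro hS z z' hz h
    rw [hnext] at hz
    have hargs : (fun i => z (.inl (args i))) = fun i => z' (.inl (args i)) :=
      funext fun i => hz.1 _
    rw [hsat] at h ⊢
    rw [← hz.auxState_eq le_rfl, ← hz.auxState_eq (by omega), ← hz.1 x, ← hargs]
    exact ⟨h.1, h.2.1, hS z z' (hz.mono (by omega)) h.2.2⟩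
  refine ⟨fun hS => (hcl hS).stmtConstr (by omega) (by omega), fun z h => ?_,
    fun hS z hz hs => ?_, fun z => ⟨fun h => absurd h hne, fun _ => ?_⟩⟩
  · obtain ⟨h, hr⟩ := rel_of_sat_stmtConstr h
    obtain ⟨h₁, h₂, h₃⟩ := (hsat z).1 h
    exact ⟨h₃, fun _ => ⟨_, _, h₂, hr, h₁⟩⟩
  · obtain ⟨y, y', hy, hyy, hr⟩ := hs hne
    have h₁ := agreeBelow_setAux z S.next y
    have h₂ := agreeBelow_setAux (setAux z S.next y) (S.next + n) y'
    have h₃ := h₁.trans (h₂.mono (by omega))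
    have hy₁ : auxState (setAux (setAux z S.next y) (S.next + n) y') n S.next = y := by
      rw [← h₂.auxState_eq le_rfl, auxState_setAux]
    obtain ⟨z', hz', hs'⟩ := exists_sat_stmtConstr (s := s) (σ := σ) (x := S.next)
      (x' := S.next + n) (S := S') (hcl hS) (by omega) (by omega)
      (z := setAux (setAux z S.next y) (S.next + n) y')
      ((hsat _).2 ⟨by rwa [auxState_setAux], by rwa [hy₁], hS z _ h₃ hz⟩)
      (by rwa [auxState_setAux, hy₁])
    exact ⟨z', fun x => (h₃.1 x).trans (hz'.1 x), hs'⟩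
  · rw [objective_stmtConstr, hobj]

theorem lpStep_exprConstr (T : Matrix (Fin m) (Fin n) ℝ) (x : X) (e : Expr n m X) (σ : e.Strat)
    (S : LPState X) : LPStep T x (e.apply σ) S (exprConstr T x e σ S).val := by
  induction e with
  | atom a =>
    cases a with
    | const c => exact lpStep_const T x c σ S
    | abs s j args => exact lpStep_abs T x s j args σ S
  | sup e₀ e₁ h₀ h₁ =>
    cases σ with
    | inl σ => exact h₀ σ
    | inr σ => exact h₁ σ

theorem sound_systemConstr {T : Matrix (Fin m) (Fin n) ℝ} {E : System n m X} {σ : Strategy E}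
    (l : List X) {S : LPState X} {z : LPVar X → ℝ} (h : (systemConstr T E σ l S).val.Sat z) :
    S.Sat z ∧ ∀ x ∈ l, (E x).apply (σ x) ≠ .const ⊥ →
      ((E x).apply (σ x)).Supports T (fun y => z (.inl y)) (z (.inl x)) := by
  induction l generalizing S with
  | nil => exact ⟨h, by simp⟩
  | cons x l ih =>
    obtain ⟨h, hl⟩ := ih h
    obtain ⟨h, hx⟩ := (lpStep_exprConstr T x (E x) (σ x) S).sound z h
    exact ⟨h, List.forall_mem_cons.2 ⟨hx, hl⟩⟩

theorem complete_systemConstr {T : Matrix (Fin m) (Fin n) ℝ} {E : System n m X} {σ : Strategy E}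
    (l : List X) {S : LPState X} (hS : S.Closed) {z : LPVar X → ℝ} (hz : S.Sat z)
    (h : ∀ x, (E x).apply (σ x) ≠ .const ⊥ →
      ((E x).apply (σ x)).Supports T (fun y => z (.inl y)) (z (.inl x))) :
    ∃ z', (∀ y, z (.inl y) = z' (.inl y)) ∧ (systemConstr T E σ l S).val.Sat z' := by
  induction l generalizing S z with
  | nil => exact ⟨z, fun _ => rfl, hz⟩
  | cons x l ih =>
    have hstep := lpStep_exprConstr T x (E x) (σ x) S
    obtain ⟨z₁, hz₁, hs₁⟩ := hstep.complete hS z hz (h x)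
    obtain ⟨z₂, hz₂, hs₂⟩ := ih (hstep.closed hS) hs₁ (fun y => by
      simp only [← hz₁]; exact h y)
    exact ⟨z₂, fun y => (hz₁ y).trans (hz₂ y), hs₂⟩

open Classical in
theorem eval_objective_systemConstr (T : Matrix (Fin m) (Fin n) ℝ) (E : System n m X)
    (σ : Strategy E) (l : List X) (S : LPState X) (z : LPVar X → ℝ) :
    (systemConstr T E σ l S).val.objective.eval z =
      (l.map fun x => if (E x).apply (σ x) = .const ⊥ then 0 else z (.inl x)).sum +
        S.objective.eval z := by
  induction l generalizing S with
  | nil => simp [systemConstr]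
  | cons x l ih =>
    have hstep := (lpStep_exprConstr T x (E x) (σ x) S).objective z
    simp only [systemConstr, val_bind, ih, List.map_cons, List.sum_cons]
    by_cases hx : (E x).apply (σ x) = .const ⊥
    · rw [hstep.1 hx, if_pos hx]; ring
    · rw [hstep.2 hx, if_neg hx]; ring

open Classical in
theorem eval_objective_strategyLP [Fintype X] (T : Matrix (Fin m) (Fin n) ℝ) (E : System n m X)
    (σ : Strategy E) (z : LPVar X → ℝ) : (strategyLP T E σ).val.objective.eval z =
      ∑ x, if (E x).apply (σ x) = .const ⊥ then 0 else z (.inl x) := by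
  rw [← Finset.sum_map_toList]
  simpa [strategyLP, LinExpr.eval] using eval_objective_systemConstr T E σ Finset.univ.toList
    ⟨.const 0, [], 0⟩ z

theorem supports_of_isFeasible [Fintype X] {T : Matrix (Fin m) (Fin n) ℝ} {E : System n m X}
    {σ : Strategy E} {z : LPVar X → ℝ} (h : (strategyLP T E σ).val.IsFeasible z) {x : X}
    (hx : (E x).apply (σ x) ≠ .const ⊥) :
    ((E x).apply (σ x)).Supports T (fun y => z (.inl y)) (z (.inl x)) :=
  (sound_systemConstr (S := ⟨.const 0, [], 0⟩) _ h).2 x (by simp) hx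

theorem exists_isFeasible [Fintype X] {T : Matrix (Fin m) (Fin n) ℝ} {E : System n m X}
    {σ : Strategy E} {w : X → ℝ}
    (h : ∀ x, (E x).apply (σ x) ≠ .const ⊥ → ((E x).apply (σ x)).Supports T w (w x)) :
    ∃ z, (∀ x, z (.inl x) = w x) ∧ (strategyLP T E σ).val.IsFeasible z := by
  obtain ⟨z, hz, hs⟩ := complete_systemConstr (T := T) (E := E) (σ := σ) Finset.univ.toList
    (S := ⟨.const 0, [], 0⟩) (fun _ _ _ _ _ h => by simp at h) (z := Sum.elim w fun _ => 0)
    (fun _ h => by simp at h) h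
  exact ⟨z, fun x => (hz x).symm, hs⟩

theorem lpAssignment_of_ne {E : System n m X} {σ : Strategy E} {x : X}
    (h : (E x).apply (σ x) ≠ .const ⊥) (z : LPVar X → ℝ) :
    lpAssignment E σ z x = z (.inl x) := if_neg h

/-- The solutions of the linear program are the pre-solutions of the strategy's system, so the
greatest pre-solution is the unique optimum. -/
theorem Invariant.strategyLP [Fintype X] {T : Matrix (Fin m) (Fin n) ℝ} {E : System n m X}
    {σ : Strategy E} {ρ : X → EReal} (h : Invariant T E σ ρ) :
    (∃ z, (strategyLP T E σ).val.IsOptimal z) ∧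
      ∀ z, (strategyLP T E σ).val.IsOptimal z → lpAssignment E σ z = ρ := by
  classical
  have hbot : ∀ x, (E x).apply (σ x) = .const ⊥ → ρ x = ⊥ := fun x hx =>
    not_bot_lt_iff.1 fun h' => h.bot_lt_iff.1 h' hx
  have hcoe : ∀ x, (E x).apply (σ x) ≠ .const ⊥ → ((ρ x).toReal : EReal) = ρ x := fun x hx =>
    EReal.coe_toReal (h.lt_top x).ne (h.bot_lt x hx).ne'
  have hpos : ∀ x, (E x).apply (σ x) ≠ .const ⊥ → ⊥ < ((E x).apply (σ x)).eval T ρ :=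
    fun x hx => (h.bot_lt x hx).trans_le (congrFun h.sol x).ge
  have hle : ∀ z, (TemplateAnalysis.strategyLP T E σ).val.IsFeasible z →
      ∀ x, (E x).apply (σ x) ≠ .const ⊥ → z (.inl x) ≤ (ρ x).toReal := by
    intro z hz x hx
    have : lpAssignment E σ z ≤ ρ := by
      refine h.le_of_le_sem (fun y => ?_) (fun y hy => ?_) fun y => ?_
      · unfold lpAssignment; split
        · exact bot_lt_top
        · exact EReal.coe_lt_top _
      · refine h.bot_lt y fun he => ?_
        simp [lpAssignment, he] at hy
      · by_cases hy : (E y).apply (σ y) = .const ⊥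
        · simp [lpAssignment, hy]
        · rw [lpAssignment_of_ne hy]
          refine (supports_of_isFeasible hz hy).le_eval.trans (le_of_eq ?_)
          exact Atom.eval_congr T (hpos y hy) fun y' hy' =>
            (lpAssignment_of_ne (h.bot_lt_iff.1 hy') z).symm
    have := this x
    rw [lpAssignment_of_ne hx, ← hcoe x hx] at this
    exact EReal.coe_le_coe_iff.1 this
  obtain ⟨z₀, hz₀, hf₀⟩ : ∃ z, (∀ x, z (.inl x) = (ρ x).toReal) ∧
      (TemplateAnalysis.strategyLP T E σ).val.IsFeasible z := by
    refine exists_isFeasible fun x hx => Expr.supports_of_eval_eq ?_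
    rw [hcoe x hx]
    refine Eq.trans ?_ (congrFun h.sol x)
    exact Atom.eval_congr T (hpos x hx) fun y hy => hcoe y (h.bot_lt_iff.1 hy)
  refine ⟨⟨z₀, hf₀, fun z hz => ?_⟩, fun z hz => ?_⟩
  · rw [eval_objective_strategyLP, eval_objective_strategyLP]
    refine Finset.sum_le_sum fun x _ => ?_
    split
    · exact le_rfl
    · rw [hz₀]; exact hle z hz x ‹_›
  · have hterm : ∀ x ∈ Finset.univ,
        (if (E x).apply (σ x) = .const ⊥ then 0 else z (.inl x)) ≤
        if (E x).apply (σ x) = .const ⊥ then 0 else z₀ (.inl x) := by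
      intro x _
      split
      · exact le_rfl
      · rw [hz₀]; exact hle z hz.1 x ‹_›
    have hopt := hz.2 z₀ hf₀
    rw [eval_objective_strategyLP, eval_objective_strategyLP] at hopt
    have heq := (Finset.sum_eq_sum_iff_of_le hterm).1 ((Finset.sum_le_sum hterm).antisymm hopt)
    ext x
    by_cases hx : (E x).apply (σ x) = .const ⊥
    · simp [lpAssignment, hx, hbot x hx]
    · have := heq x (Finset.mem_univ x)
      rw [if_neg hx, if_neg hx, hz₀] at this
      rw [lpAssignment_of_ne hx, this, hcoe x hx]

/-! ### Linear size and linear construction time -/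

theorem steps_sumLoop {V : Type v} {k B : ℕ} {f : Fin k → Timed (LinExpr V)}
    (h : ∀ i, (f i).steps = B) : (sumLoop k f).steps = k * (B + 1) + 1 := by
  induction k with
  | zero => simp [sumLoop]
  | succ k ih =>
    simp only [sumLoop, steps_bind, steps_unitStep, h, ih fun i => h i.succ]
    ring

theorem size_sumLoop {V : Type v} {k B : ℕ} {f : Fin k → Timed (LinExpr V)}
    (h : ∀ i, (f i).val.size = B) : (sumLoop k f).val.size = k * (B + 1) + 1 := by
  induction k with
  | zero => simp [sumLoop, LinExpr.size]
  | succ k ih =>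
    simp only [sumLoop, val_bind, val_unitStep, LinExpr.size, h, ih fun i => h i.succ]
    ring

@[simp] theorem steps_rowExpr {V : Type v} (a : Fin n → ℝ) (y : Fin n → V) :
    (rowExpr a y).steps = n * 3 + 1 :=
  steps_sumLoop fun _ => rfl

@[simp] theorem size_rowExpr {V : Type v} (a : Fin n → ℝ) (y : Fin n → V) :
    (rowExpr a y).val.size = n * 3 + 1 :=
  size_sumLoop fun _ => rfl

@[simp] theorem steps_affExpr {V : Type v} (a : Fin n → ℝ) (b : ℝ) (y : Fin n → V) :
    (affExpr a b y).steps = n * 3 + 3 := by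
  simp [affExpr]

@[simp] theorem size_affExpr {V : Type v} (a : Fin n → ℝ) (b : ℝ) (y : Fin n → V) :
    (affExpr a b y).val.size = n * 3 + 3 := by
  simp [affExpr, LinExpr.size]

@[simp] theorem steps_mkTrue : mkTrue.steps = 2 := rfl
@[simp] theorem size_mkTrue : mkTrue.val.size = 3 := rfl
@[simp] theorem steps_mkFalse : mkFalse.steps = 3 := rfl
@[simp] theorem size_mkFalse : mkFalse.val.size = 3 := rfl
@[simp] theorem steps_mkEq (e₁ e₂ : LinExpr ℕ) : (mkEq e₁ e₂).steps = 3 := rfl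

@[simp] theorem size_mkEq (e₁ e₂ : LinExpr ℕ) :
    (mkEq e₁ e₂).val.size = 2 * (e₁.size + e₂.size) + 3 := by
  simp only [mkEq, val_bind, val_unitStep, Formula.size]
  ring

@[simp] theorem steps_mkCase (a : ℕ) (φ₀ φ₁ : Formula) : (mkCase a φ₀ φ₁).steps = 5 := rfl

@[simp] theorem size_mkCase (a : ℕ) (φ₀ φ₁ : Formula) :
    (mkCase a φ₀ φ₁).val.size = φ₀.size + φ₁.size + 6 := by
  simp only [mkCase, val_bind, val_unitStep, Formula.size]
  ring

theorem steps_mkLeE_le (e : LinExpr ℕ) (d : EReal) : (mkLeE e d).steps ≤ 3 := by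
  unfold mkLeE
  split_ifs <;> simp

theorem size_mkLeE_le (e : LinExpr ℕ) (d : EReal) : (mkLeE e d).val.size ≤ e.size + 3 := by
  unfold mkLeE
  split_ifs <;> simp [Formula.size, LinExpr.size]

theorem steps_mkGtE_le (e : LinExpr ℕ) (d : EReal) : (mkGtE e d).steps ≤ 4 := by
  have := steps_mkLeE_le e d
  unfold mkGtE
  split_ifs <;> simp
  omega

theorem size_mkGtE_le (e : LinExpr ℕ) (d : EReal) : (mkGtE e d).val.size ≤ e.size + 4 := by
  have := size_mkLeE_le e d
  unfold mkGtE
  split_ifs <;> simp [Formula.size]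
  omega

theorem steps_andLoop_le {k B : ℕ} {f : Fin k → Timed Formula} (h : ∀ i, (f i).steps ≤ B) :
    (andLoop k f).steps ≤ k * (B + 1) + 2 := by
  induction k with
  | zero => simp [andLoop]
  | succ k ih =>
    simp only [andLoop, steps_bind, steps_unitStep]
    have h₁ := h 0
    have h₂ := ih fun i => h i.succ
    rw [Nat.succ_mul]
    omega

theorem size_andLoop_le {k B : ℕ} {f : Fin k → Timed Formula} (h : ∀ i, (f i).val.size ≤ B) :
    (andLoop k f).val.size ≤ k * (B + 1) + 3 := by
  induction k with
  | zero => simp [andLoop]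
  | succ k ih =>
    simp only [andLoop, val_bind, val_unitStep, Formula.size]
    have h₁ := h 0
    have h₂ := ih fun i => h i.succ
    rw [Nat.succ_mul]
    omega

theorem Stmt.size_pos (s : Stmt n) : 1 ≤ s.size := by
  cases s <;> simp [Stmt.size]

theorem Expr.size_pos (e : Expr n m X) : 1 ≤ e.size := by
  cases e with
  | atom a => cases a <;> simp [Expr.size, Atom.size]
  | sup e₀ e₁ => simp [Expr.size]

theorem steps_stmtFormula_le (s : Stmt n) (x x' r a : ℕ) :
    (stmtFormula s x x' r a).steps ≤ 20 * s.size := by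
  induction s generalizing x x' r a with
  | assign A b =>
    simp only [stmtFormula, steps_bind, steps_unitStep, Stmt.size]
    have := steps_andLoop_le (k := n) (B := 1 + (n * 3 + 3 + 3)) (f := fun i => do
      let l ← unitStep (LinExpr.var (block n x' i))
      let e ← affExpr (A i) (b i) (block n x)
      mkEq l e) (by simp)
    nlinarith
  | guard k A b =>
    simp only [stmtFormula, steps_bind, steps_unitStep, Stmt.size]
    have h₁ := steps_andLoop_le (k := k) (B := n * 3 + 1 + (1 + 1)) (f := fun i => do
      let e ← rowExpr (A i) (block n x)
      let c ← unitStep (LinExpr.const (b i))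
      unitStep (.le e c)) (by simp)
    have h₂ := steps_andLoop_le (k := n) (B := 1 + (1 + 3)) (f := fun j => do
      let l ← unitStep (LinExpr.var (block n x' j))
      let e ← unitStep (LinExpr.var (block n x j))
      mkEq l e) (by simp)
    nlinarith
  | seq s₀ s₁ h₀ h₁ =>
    simp only [stmtFormula, steps_bind, steps_unitStep, Stmt.size]
    have := h₀ x r (r + n) a
    have := h₁ r x' (stmtFormula s₀ x r (r + n) a).val.nextReal
      (stmtFormula s₀ x r (r + n) a).val.nextBool
    omega
  | choice s₀ s₁ h₀ h₁ =>
    simp only [stmtFormula, steps_bind, steps_unitStep, Stmt.size, steps_mkCase]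
    have := h₀ x x' r (a + 1)
    have := h₁ x x' (stmtFormula s₀ x x' r (a + 1)).val.nextReal
      (stmtFormula s₀ x x' r (a + 1)).val.nextBool
    omega

theorem size_stmtFormula_le (s : Stmt n) (x x' r a : ℕ) :
    (stmtFormula s x x' r a).val.formula.size ≤ 20 * s.size := by
  induction s generalizing x x' r a with
  | assign A b =>
    simp only [stmtFormula, val_bind, val_unitStep, Stmt.size]
    have := size_andLoop_le (k := n) (B := 2 * (1 + (n * 3 + 3)) + 3) (f := fun i => do
      let l ← unitStep (LinExpr.var (block n x' i))
      let e ← affExpr (A i) (b i) (block n x)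
      mkEq l e) (by simp [LinExpr.size])
    nlinarith
  | guard k A b =>
    simp only [stmtFormula, val_bind, val_unitStep, Stmt.size, Formula.size]
    have h₁ := size_andLoop_le (k := k) (B := n * 3 + 1 + 1 + 1) (f := fun i => do
      let e ← rowExpr (A i) (block n x)
      let c ← unitStep (LinExpr.const (b i))
      unitStep (.le e c)) (by simp [Formula.size, LinExpr.size])
    have h₂ := size_andLoop_le (k := n) (B := 2 * (1 + 1) + 3) (f := fun j => do
      let l ← unitStep (LinExpr.var (block n x' j))
      let e ← unitStep (LinExpr.var (block n x j))
      mkEq l e) (by simp [LinExpr.size])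
    nlinarith
  | seq s₀ s₁ h₀ h₁ =>
    simp only [stmtFormula, val_bind, val_unitStep, Stmt.size, Formula.size]
    have := h₀ x r (r + n) a
    have := h₁ r x' (stmtFormula s₀ x r (r + n) a).val.nextReal
      (stmtFormula s₀ x r (r + n) a).val.nextBool
    omega
  | choice s₀ s₁ h₀ h₁ =>
    simp only [stmtFormula, val_bind, val_unitStep, Stmt.size, size_mkCase]
    have := h₀ x x' r (a + 1)
    have := h₁ x x' (stmtFormula s₀ x x' r (a + 1)).val.nextReal
      (stmtFormula s₀ x x' r (a + 1)).val.nextBool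
    omega

theorem le_mul_of_fin (n : ℕ) (j : Fin m) : n ≤ m * n :=
  Nat.le_mul_of_pos_left n j.pos

theorem steps_exprFormula_le (T : Matrix (Fin m) (Fin n) ℝ) (ρ : X → EReal) (e : Expr n m X)
    (r a : ℕ) : (exprFormula T ρ e r a).steps ≤ 20 * e.size := by
  induction e generalizing r a with
  | atom α =>
    cases α with
    | const c =>
      simp only [exprFormula, atomFormula, steps_bind, steps_unitStep, Expr.size, Atom.size]
      have := steps_mkLeE_le (LinExpr.var 0) c
      simp only [val_unitStep]
      omega
    | abs s j args =>
      simp only [exprFormula, atomFormula, steps_bind, steps_unitStep, Expr.size, Atom.size,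
        steps_rowExpr, steps_mkEq]
      have h₁ := steps_andLoop_le (k := m) (B := n * 3 + 1 + 3) (f := fun i => do
        let e ← rowExpr (T i) (block n r)
        mkLeE e (ρ (args i))) (by
          intro i
          simp only [steps_bind, steps_rowExpr]
          have := steps_mkLeE_le (rowExpr (T i) (block n r)).val (ρ (args i))
          omega)
      have h₂ := steps_stmtFormula_le s r (r + n) (r + n + n) a
      have h₃ := le_mul_of_fin n j
      nlinarith
  | sup e₀ e₁ h₀ h₁ =>
    simp only [exprFormula, steps_bind, steps_unitStep, Expr.size, steps_mkCase]
    have := h₀ r (a + 1)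
    have := h₁ (exprFormula T ρ e₀ r (a + 1)).val.nextReal
      (exprFormula T ρ e₀ r (a + 1)).val.nextBool
    omega

theorem size_exprFormula_le (T : Matrix (Fin m) (Fin n) ℝ) (ρ : X → EReal) (e : Expr n m X)
    (r a : ℕ) : (exprFormula T ρ e r a).val.formula.size ≤ 20 * e.size := by
  induction e generalizing r a with
  | atom α =>
    cases α with
    | const c =>
      simp only [exprFormula, atomFormula, val_bind, val_unitStep, Expr.size, Atom.size]
      have := size_mkLeE_le (LinExpr.var 0) c
      simp only [LinExpr.size] at this
      omega
    | abs s j args =>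
      simp only [exprFormula, atomFormula, val_bind, val_unitStep, Expr.size, Atom.size,
        Formula.size, size_rowExpr, size_mkEq, LinExpr.size]
      have h₁ := size_andLoop_le (k := m) (B := n * 3 + 1 + 3) (f := fun i => do
        let e ← rowExpr (T i) (block n r)
        mkLeE e (ρ (args i))) (by
          intro i
          simpa using size_mkLeE_le (rowExpr (T i) (block n r)).val (ρ (args i)))
      have h₂ := size_stmtFormula_le s r (r + n) (r + n + n) a
      have h₃ := le_mul_of_fin n j
      nlinarith
  | sup e₀ e₁ h₀ h₁ =>
    simp only [exprFormula, val_bind, val_unitStep, Expr.size, size_mkCase]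
    have := h₀ r (a + 1)
    have := h₁ (exprFormula T ρ e₀ r (a + 1)).val.nextReal
      (exprFormula T ρ e₀ r (a + 1)).val.nextBool
    omega

theorem size_joinBot (E : System n m X) (x : X) : (E.joinBot x).size = (E x).size + 2 := rfl

theorem steps_improveFormula_le (T : Matrix (Fin m) (Fin n) ℝ) (e : Expr n m X) (ρ : X → EReal)
    (c : EReal) : (improveFormula T e ρ c).steps ≤ 20 * e.size + 6 := by
  simp only [improveFormula, steps_bind, steps_unitStep]
  have := steps_exprFormula_le T ρ e 1 0
  have := steps_mkGtE_le (LinExpr.var 0) c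
  simp only [val_unitStep]
  omega

theorem size_improveFormula_le (T : Matrix (Fin m) (Fin n) ℝ) (e : Expr n m X) (ρ : X → EReal)
    (c : EReal) : (improveFormula T e ρ c).val.size ≤ 20 * e.size + 6 := by
  simp only [improveFormula, val_bind, val_unitStep, Formula.size]
  have := size_exprFormula_le T ρ e 1 0
  have := size_mkGtE_le (LinExpr.var 0) c
  simp only [LinExpr.size] at this
  omega

/-- The total size of a list of constraints. -/
def constrSize (L : List (Constr X)) : ℕ := (L.map fun c => c.1.size + c.2.size + 1).sum

@[simp] theorem constrSize_cons (c : Constr X) (L : List (Constr X)) :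
    constrSize (c :: L) = c.1.size + c.2.size + 1 + constrSize L := by
  simp [constrSize]

theorem steps_consLoop_le {k B : ℕ} {f : Fin k → Timed (Constr X)} (L : List (Constr X))
    (h : ∀ i, (f i).steps ≤ B) : (consLoop k f L).steps ≤ k * (B + 1) + 1 := by
  induction k with
  | zero => simp [consLoop]
  | succ k ih =>
    simp only [consLoop, steps_bind, steps_unitStep]
    have h₁ := h 0
    have h₂ := ih fun i => h i.succ
    rw [Nat.succ_mul]
    omega

theorem constrSize_consLoop_le {k B : ℕ} {f : Fin k → Timed (Constr X)} (L : List (Constr X))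
    (h : ∀ i, (f i).val.1.size + (f i).val.2.size + 1 ≤ B) :
    constrSize (consLoop k f L).val ≤ k * B + constrSize L := by
  induction k with
  | zero => simp [consLoop]
  | succ k ih =>
    simp only [consLoop, val_bind, val_unitStep, constrSize_cons]
    have h₁ := h 0
    have h₂ := ih fun i => h i.succ
    rw [Nat.succ_mul]
    omega

/-- The size of a linear program under construction. -/
def LPState.size (S : LPState X) : ℕ := S.objective.size + constrSize S.constraints

theorem steps_stmtConstr_le (s : Stmt n) (σ : s.Strat) (x x' : ℕ) (S : LPState X) :
    (stmtConstr s σ x x' S).steps ≤ 20 * s.size := by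
  induction s generalizing x x' S with
  | assign A b =>
    simp only [stmtConstr, steps_bind, steps_unitStep, Stmt.size]
    refine (Nat.add_le_add (steps_consLoop_le (B := 1 + (n * 3 + 3 + 1)) _ (by simp))
      (Nat.add_le_add_right (steps_consLoop_le (B := 1 + (n * 3 + 3 + 1)) _ (by simp)) _)).trans ?_
    nlinarith
  | guard k A b =>
    simp only [stmtConstr, steps_bind, steps_unitStep, Stmt.size]
    refine (Nat.add_le_add (steps_consLoop_le (B := n * 3 + 1 + (1 + 1)) _ (by simp))
      (Nat.add_le_add (steps_consLoop_le (B := 1 + (1 + 1)) _ (by simp))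
      (Nat.add_le_add_right (steps_consLoop_le (B := 1 + (1 + 1)) _ (by simp)) _))).trans ?_
    nlinarith
  | seq s₀ s₁ h₀ h₁ =>
    simp only [stmtConstr, steps_bind, steps_unitStep, val_unitStep, Stmt.size]
    refine (Nat.add_le_add_left (Nat.add_le_add (h₀ ..) (h₁ ..)) 1).trans ?_
    omega
  | choice s₀ s₁ h₀ h₁ =>
    simp only [stmtConstr, steps_bind, steps_unitStep, val_unitStep, Stmt.size]
    split
    · have := h₁ σ.2.2 x x' S
      omega
    · have := h₀ σ.2.1 x x' S
      omega

theorem size_stmtConstr_le (s : Stmt n) (σ : s.Strat) (x x' : ℕ) (S : LPState X) :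
    (stmtConstr s σ x x' S).val.size ≤ S.size + 20 * s.size := by
  induction s generalizing x x' S with
  | assign A b =>
    simp only [stmtConstr, val_bind, val_unitStep, Stmt.size, LPState.size]
    refine (Nat.add_le_add_left ((constrSize_consLoop_le (B := n * 3 + 5) _ ?_).trans
      (Nat.add_le_add_left (constrSize_consLoop_le (B := n * 3 + 5) _ ?_) _)) _).trans ?_
    · intro i; simp [LinExpr.size]
    · intro i; simp [LinExpr.size]; omega
    · nlinarith
  | guard k A b =>
    simp only [stmtConstr, val_bind, val_unitStep, Stmt.size, LPState.size]
    refine (Nat.add_le_add_left ((constrSize_consLoop_le (B := 3) _ ?_).trans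
      (Nat.add_le_add_left ((constrSize_consLoop_le (B := 3) _ ?_).trans
      (Nat.add_le_add_left (constrSize_consLoop_le (B := n * 3 + 3) _ ?_) _)) _)) _).trans ?_
    · intro i; simp [LinExpr.size]
    · intro i; simp [LinExpr.size]
    · intro i; simp [LinExpr.size]
    · nlinarith
  | seq s₀ s₁ h₀ h₁ =>
    simp only [stmtConstr, val_bind, val_unitStep, Stmt.size]
    refine ((h₁ ..).trans (Nat.add_le_add_right (h₀ ..) _)).trans ?_
    simp only [LPState.size]
    omega
  | choice s₀ s₁ h₀ h₁ =>
    simp only [stmtConstr, val_bind, val_unitStep, Stmt.size]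
    split
    · have := h₁ σ.2.2 x x' S
      omega
    · have := h₀ σ.2.1 x x' S
      omega

theorem steps_exprConstr_le (T : Matrix (Fin m) (Fin n) ℝ) (x : X) (e : Expr n m X)
    (σ : e.Strat) (S : LPState X) : (exprConstr T x e σ S).steps ≤ 20 * e.size := by
  induction e with
  | atom a =>
    cases a with
    | const c =>
      simp only [exprConstr, atomConstr, Expr.size, Atom.size]
      split_ifs <;> simp
    | abs s j args =>
      simp only [exprConstr, atomConstr, steps_bind, steps_unitStep, Expr.size, Atom.size,
        steps_rowExpr]
      have h₁ := steps_consLoop_le (k := m) (B := n * 3 + 1 + (1 + 1)) (f := fun i => do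
        let e ← rowExpr (T i) (auxBlock X n S.next)
        let t ← unitStep (LinExpr.var (Sum.inl (args i)))
        unitStep (e, t)) S.constraints (by simp)
      have h₃ := le_mul_of_fin n j
      refine (Nat.add_le_add_left (Nat.add_le_add_left (Nat.add_le_add h₁ (Nat.add_le_add_left
        (Nat.add_le_add_left (Nat.add_le_add_left (Nat.add_le_add_left
        (steps_stmtConstr_le ..) _) _) _) _)) _) _).trans ?_
      nlinarith
  | sup e₀ e₁ h₀ h₁ =>
    cases σ with
    | inl σ =>
      simp only [exprConstr, steps_bind, steps_unitStep, val_unitStep, Expr.size]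
      have := h₀ σ
      omega
    | inr σ =>
      simp only [exprConstr, steps_bind, steps_unitStep, val_unitStep, Expr.size]
      have := h₁ σ
      omega

theorem size_exprConstr_le (T : Matrix (Fin m) (Fin n) ℝ) (x : X) (e : Expr n m X)
    (σ : e.Strat) (S : LPState X) : (exprConstr T x e σ S).val.size ≤ S.size + 20 * e.size := by
  induction e with
  | atom a =>
    cases a with
    | const c =>
      simp only [exprConstr, atomConstr, Expr.size, Atom.size]
      split_ifs <;> simp [LPState.size, LinExpr.size] <;> omega
    | abs s j args =>
      simp only [exprConstr, atomConstr, val_bind, val_unitStep, Expr.size, Atom.size]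
      have h₁ := constrSize_consLoop_le (k := m) (B := n * 3 + 3) (f := fun i => do
        let e ← rowExpr (T i) (auxBlock X n S.next)
        let t ← unitStep (LinExpr.var (Sum.inl (args i)))
        unitStep (e, t)) S.constraints (by simp [LinExpr.size])
      have h₃ := le_mul_of_fin n j
      refine (size_stmtConstr_le ..).trans ?_
      simp only [LPState.size, LinExpr.size, constrSize_cons, size_rowExpr]
      nlinarith
  | sup e₀ e₁ h₀ h₁ =>
    cases σ with
    | inl σ =>
      simp only [exprConstr, val_bind, val_unitStep, Expr.size]
      have := h₀ σ
      omega
    | inr σ =>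
      simp only [exprConstr, val_bind, val_unitStep, Expr.size]
      have := h₁ σ
      omega

theorem steps_systemConstr_le (T : Matrix (Fin m) (Fin n) ℝ) (E : System n m X) (σ : Strategy E)
    (l : List X) (S : LPState X) :
    (systemConstr T E σ l S).steps ≤ 20 * (l.map fun x => (E x).size).sum + 1 := by
  induction l generalizing S with
  | nil => simp [systemConstr]
  | cons x l ih =>
    simp only [systemConstr, steps_bind, List.map_cons, List.sum_cons]
    have := steps_exprConstr_le T x (E x) (σ x) S
    have := ih (exprConstr T x (E x) (σ x) S).val
    omega

theorem size_systemConstr_le (T : Matrix (Fin m) (Fin n) ℝ) (E : System n m X) (σ : Strategy E)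
    (l : List X) (S : LPState X) :
    (systemConstr T E σ l S).val.size ≤ S.size + 20 * (l.map fun x => (E x).size).sum := by
  induction l generalizing S with
  | nil => simp [systemConstr]
  | cons x l ih =>
    simp only [systemConstr, val_bind, List.map_cons, List.sum_cons]
    have := size_exprConstr_le T x (E x) (σ x) S
    have := ih (exprConstr T x (E x) (σ x) S).val
    omega

theorem steps_strategyLP_le [Fintype X] (T : Matrix (Fin m) (Fin n) ℝ) (E : System n m X)
    (σ : Strategy E) : (strategyLP T E σ).steps ≤ 20 * E.size := by
  have := steps_systemConstr_le T E σ Finset.univ.toList ⟨.const 0, [], 0⟩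
  rw [Finset.sum_map_toList] at this
  simp only [strategyLP, steps_bind, steps_unitStep, val_unitStep, System.size]
  omega

theorem size_strategyLP_le [Fintype X] (T : Matrix (Fin m) (Fin n) ℝ) (E : System n m X)
    (σ : Strategy E) : (strategyLP T E σ).val.size ≤ 20 * E.size := by
  have := size_systemConstr_le T E σ Finset.univ.toList ⟨.const 0, [], 0⟩
  rw [Finset.sum_map_toList] at this
  have hs : (strategyLP T E σ).val.size =
    (systemConstr T E σ Finset.univ.toList ⟨.const 0, [], 0⟩).val.size := rfl
  have h0 : (⟨.const 0, [], 0⟩ : LPState X).size = 1 := rfl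
  rw [hs, System.size]
  omega

theorem System.size_joinBot_le [Fintype X] (E : System n m X) : E.joinBot.size ≤ 3 * E.size := by
  have h : ∑ x, (E.joinBot x).size ≤ ∑ x, 3 * (E x).size :=
    Finset.sum_le_sum fun x _ => by
      have := (E x).size_pos
      rw [size_joinBot]
      omega
  rw [← Finset.mul_sum] at h
  simp only [System.size]
  omega

end TemplateAnalysis

theorem theorem3 :
    ∃ C : ℕ, ∀ (n m : ℕ) (T : Matrix (Fin m) (Fin n) ℝ) (X : Type*) [Fintype X]
      (E : System n m X), (∀ x, E.leastSol T x < ⊤) →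
      -- every run performs at most `|Σ| + |X|` improvement steps, and yields `μ⟦E⟧` when it stops
      (∀ (k : ℕ) (σ : Strategy E.joinBot) (ρ : X → EReal), Reaches T E k σ ρ →
        k ≤ Nat.card (Strategy E) + Fintype.card X ∧
        (ρ ∈ E.joinBot.Sol T → ρ = E.leastSol T) ∧
        (ρ ∉ E.joinBot.Sol T →
          -- the loop body can be evaluated once more
          (∃ σ' ρ', Reaches T E (k + 1) σ' ρ') ∧
          -- models of one formula for each variable yield an improvement
          (∀ ans : X → Option Interp,
            (∀ x, IsAnswer (improveFormula T (E.joinBot x) ρ (ρ x)).val (ans x)) →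
            IsImprovement T E.joinBot σ ρ (nextStrategy E.joinBot σ ans)) ∧
          -- an optimal solution of one linear program yields the next assignment
          (∀ σ' : Strategy E.joinBot, IsImprovement T E.joinBot σ ρ σ' →
            (∃ z, (strategyLP T E.joinBot σ').val.IsOptimal z) ∧
            ∀ z, (strategyLP T E.joinBot σ').val.IsOptimal z →
              IsLeastSolAbove T (E.joinBot.apply σ') ρ (lpAssignment E.joinBot σ' z)))) ∧
      -- the formulas have linear size and are constructed in linear time
      (∀ (ρ : X → EReal) (x : X),
        (improveFormula T (E.joinBot x) ρ (ρ x)).steps ≤ C * (E x).size ∧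
        (improveFormula T (E.joinBot x) ρ (ρ x)).val.size ≤ C * (E x).size) ∧
      -- the linear programs have linear size and are constructed in linear time
      (∀ σ : Strategy E.joinBot,
        (strategyLP T E.joinBot σ).steps ≤ C * E.size ∧
        (strategyLP T E.joinBot σ).val.size ≤ C * E.size) := by
  refine ⟨100, fun n m T X _ E hE => ⟨fun k σ ρ hr => ⟨hr.le_card hE, ?_, ?_⟩, ?_, ?_⟩⟩
  · intro hsol
    rw [System.Sol, Set.mem_ofPred_eq, E.sem_joinBot] at hsol
    exact (hr.invariant hE).2.antisymm ((E.sem T).lfp_le_fixed hsol)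
  · intro hns
    have hinv := (hr.invariant hE).1
    refine ⟨?_, fun ans hans => isImprovement_nextStrategy hinv.sol hans, fun σ' hi => ?_⟩
    · choose ans hans using fun x => exists_isAnswer (improveFormula T (E.joinBot x) ρ (ρ x)).val
      have hi := isImprovement_nextStrategy hinv.sol hans
      obtain ⟨ρ', hl⟩ := exists_isLeastSolAbove (hinv.le_sem hi)
      exact ⟨_, ρ', hr.step hns hi hl⟩
    · obtain ⟨ρ', hl⟩ := exists_isLeastSolAbove (hinv.le_sem hi)
      obtain ⟨hex, hopt⟩ := ((hr.step hns hi hl).invariant hE).1.strategyLP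
      exact ⟨hex, fun z hz => by rwa [hopt z hz]⟩
  · intro ρ x
    have h₁ := steps_improveFormula_le T (E.joinBot x) ρ (ρ x)
    have h₂ := size_improveFormula_le T (E.joinBot x) ρ (ρ x)
    have h₃ := size_joinBot E x
    have h₄ := (E x).size_pos
    constructor <;> omega
  · intro σ
    have h₁ := steps_strategyLP_le T E.joinBot σ
    have h₂ := size_strategyLP_le T E.joinBot σ
    have h₃ := E.size_joinBot_le
    constructor <;> omega
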